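/- A Salem number is a real algebraic integer $\alpha>1$ of degree $d=2+2s$ with $s>0$, having $1/\alpha$ as a conjugate and its remaining $2s$ conjugates on the unit circle. For $a,b,c\ge1$ let $T_{a,b,c}$ be the tree formed from three paths with $a$, $b$ and $c$ vertices by identifying one end vertex of each. "Graph" means finite simple graph, and the largest eigenvalue of a graph is that of its adjacency matrix. There are exactly six Salem numbers $\alpha<1.3$ of degree $d<12$. One of them, $\alpha_{\rm not}$, has minimal polynomial $$x^{10}-x^6-x^5-x^4+1,$$ and the five others, $\alpha_1<\alpha_2<\alpha_3<\alpha_4<\alpha_5$, have the minimal polynomials $$\begin{aligned} P_1&=x^{10}+x^9-x^7-x^6-x^5-x^4-x^3+x+1,\\ P_2&=x^{10}-x^7-x^5-x^3+1,\\ P_3&=x^{10}-x^8-x^5-x^2+1,\\ P_4&=x^8-x^5-x^4-x^3+1,\\ P_5&=x^{10}-x^8-x^7+x^5-x^3-x^2+1, \end{aligned}$$ respectively. Among the six, $\alpha_{\rm not}$ is the only one for which $\alpha^{1/2}+\alpha^{-1/2}$ is not the largest eigenvalue of any graph. For $m=1,\dots,5$ the number $\alpha_m^{1/2}+\alpha_m^{-1/2}$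 is the largest eigenvalue of the tree $T_{2,3,6+m}$, and $\alpha_4^{1/2}+\alpha_4^{-1/2}$ is also the largest eigenvalue of the tree $T_{2,4,5}$. -/

import Mathlib

open Polynomial

/-- A Salem number: a real algebraic integer `α > 1` such that `α⁻¹` is a conjugate of `α`, at least
one conjugate lies on the unit circle, and every conjugate other than `α` and `α⁻¹` lies on the
unit circle. -/
def IsSalemNumber (α : ℝ) : Prop :=
  1 < α ∧ IsIntegral ℤ α ∧
    aeval (α⁻¹) (minpoly ℚ α) = 0 ∧
    (∃ z : ℂ, aeval z (minpoly ℚ α) = 0 ∧ ‖z‖ = 1) ∧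
    ∀ z : ℂ, aeval z (minpoly ℚ α) = 0 → z = (α : ℂ) ∨ z = ((α⁻¹ : ℝ) : ℂ) ∨ ‖z‖ = 1

open Classical in
/-- `l` is the largest eigenvalue of the adjacency matrix of the finite graph `G`. -/
def IsLargestAdjEigenvalue {V : Type*} [Fintype V] (G : SimpleGraph V) (l : ℝ) : Prop :=
  IsGreatest {μ : ℝ | Module.End.HasEigenvalue (Matrix.toLin' (G.adjMatrix ℝ)) μ} l

/-- `l` is the largest adjacency eigenvalue of some finite simple graph (every finite graph is
isomorphic to one with vertex set `Fin n`; connectedness is not required). -/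
def IsLargestAdjEigenvalueOfSomeGraph (l : ℝ) : Prop :=
  ∃ (n : ℕ) (G : SimpleGraph (Fin n)), IsLargestAdjEigenvalue G l

/-- The vertices of the tree `T_{a,b,c}`: a centre, and three arms with `a - 1`, `b - 1`, `c - 1`
further vertices, numbered outwards from the centre. -/
abbrev TripodVertex (a b c : ℕ) : Type :=
  Option (Fin (a - 1) ⊕ Fin (b - 1) ⊕ Fin (c - 1))

/-- `TripodStep v w`: `w` is the vertex next to `v` on an arm, going outwards. -/
def TripodStep {a b c : ℕ} : TripodVertex a b c → TripodVertex a b c → Prop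
  | none, some (.inl j) => j.val = 0
  | none, some (.inr (.inl j)) => j.val = 0
  | none, some (.inr (.inr j)) => j.val = 0
  | some (.inl i), some (.inl j) => i.val + 1 = j.val
  | some (.inr (.inl i)), some (.inr (.inl j)) => i.val + 1 = j.val
  | some (.inr (.inr i)), some (.inr (.inr j)) => i.val + 1 = j.val
  | _, _ => False

/-- The tree `T_{a,b,c}` (`a, b, c ≥ 1`): three paths with `a`, `b` and `c` vertices, joined by
identifying one end vertex of each. -/
def tripodTree (a b c : ℕ) : SimpleGraph (TripodVertex a b c) :=
  SimpleGraph.fromRel TripodStep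

/-- The number `α^{1/2} + α^{-1/2}` attached to a Salem number `α`. -/
noncomputable def graphValue (α : ℝ) : ℝ := √α + 1 / √α

/-- The polynomial `x^10 - x^6 - x^5 - x^4 + 1`. -/
noncomputable def notPoly : ℚ[X] := X ^ 10 - X ^ 6 - X ^ 5 - X ^ 4 + 1

/-- The polynomials `P_1, …, P_5` (the index `i : Fin 5` stands for `P_{i+1}`). -/
noncomputable def salemPoly : Fin 5 → ℚ[X] :=
  ![X ^ 10 + X ^ 9 - X ^ 7 - X ^ 6 - X ^ 5 - X ^ 4 - X ^ 3 + X + 1,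
    X ^ 10 - X ^ 7 - X ^ 5 - X ^ 3 + 1,
    X ^ 10 - X ^ 8 - X ^ 5 - X ^ 2 + 1,
    X ^ 8 - X ^ 5 - X ^ 4 - X ^ 3 + 1,
    X ^ 10 - X ^ 8 - X ^ 7 + X ^ 5 - X ^ 3 - X ^ 2 + 1]

/-! Put `β = α + α⁻¹`. A Salem number `α < 1.3` of degree below 12 corresponds to an algebraic
integer `β` in `(2, 2.07)` of degree at most 5 whose other conjugates all lie in `(-2, 2)`. Moreover
`l = √α + 1/√α` satisfies `l ^ 2 - 2 = β`, so both halves of the theorem can be read off from `β`.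

Classification. Let `f` be the minimal polynomial of `β` over `ℤ`. The integers `f(-2), f(-1), f(0),
f(1), f(2)` are nonzero, and a product of powers of them is the product, over the roots `x` of `f`,
of an auxiliary function of `x` such as `(-2 - x) (-1 - x) (2 - x) ^ 3`. On `(-2, 2)` such a
function is bounded, and at `β` it is small because of the factor `2 - β`. Degrees up to 3 are
impossible (`cubic_value_eq_zero`, `quadratic_value_eq_zero`). In degrees 4 and 5 finitely many
value vectors remain; a kernel-checked search, sharpened by Newton's inequalities for real-rooted
polynomials, leaves one quartic and five quintics (`quartic_classification`,
`quintic_classification`). Conversely, sign changes show that each of these six has the required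
root pattern (`tracePoly_roots`). Irreducibility follows from the classification itself, since the
six large roots lie in disjoint intervals (`minpoly_traceValue`).

Graphs. A positive eigenvector belongs to the largest eigenvalue, so for the trees it is enough to
exhibit one. A Chebyshev-type sequence along each arm satisfies all equations except the one at the
centre, and that one is a multiple of the trace polynomial (`tripod_two_three_center`,
`tripod_two_four_center`).

For `α_not` one has `2.0095 < l < 2.0097`. Suppose that a graph has largest eigenvalue `l`, take a
nonnegative eigenvector and look at a vertex where it is maximal. The ratios of the neighbouring
entries to this entry sum to `l`. Each ratio either is one of the discrete values produced by a
pendant path or exceeds a threshold (`ratio_dichotomy`), and no admissible combination has sum `l`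
(`not_isLargestAdjEigenvalue`). -/

/-! ### Perron–Frobenius facts for adjacency matrices -/

section Perron

variable {V : Type*} [Fintype V]

open Classical in
/-- The value at `v` of the adjacency operator of `G` applied to `f`. -/
noncomputable def SimpleGraph.adjSum (G : SimpleGraph V) (f : V → ℝ) (v : V) : ℝ :=
  ∑ w, if G.Adj v w then f w else 0

open Classical in
theorem SimpleGraph.adjMatrix_mulVec_eq_adjSum (G : SimpleGraph V) (f : V → ℝ) :
    (G.adjMatrix ℝ).mulVec f = G.adjSum f := by
  ext v
  simp [Matrix.mulVec, dotProduct, SimpleGraph.adjSum, SimpleGraph.adjMatrix_apply]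

open Classical in
theorem SimpleGraph.hasEigenvalue_adjMatrix_iff (G : SimpleGraph V) (μ : ℝ) :
    Module.End.HasEigenvalue (Matrix.toLin' (G.adjMatrix ℝ)) μ ↔
      ∃ f : V → ℝ, f ≠ 0 ∧ ∀ v, G.adjSum f v = μ * f v := by
  constructor
  · intro h
    obtain ⟨f, hf⟩ := h.exists_hasEigenvector
    refine ⟨f, hf.2, fun v => ?_⟩
    have h1 := hf.apply_eq_smul
    rw [Matrix.toLin'_apply, G.adjMatrix_mulVec_eq_adjSum] at h1
    exact congrFun h1 v
  · rintro ⟨f, hf, h⟩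
    refine Module.End.hasEigenvalue_of_hasEigenvector (x := f) ⟨?_, hf⟩
    rw [Module.End.mem_eigenspace_iff, Matrix.toLin'_apply, G.adjMatrix_mulVec_eq_adjSum]
    ext v
    exact h v

/-- A positive eigenvector of the adjacency matrix belongs to the largest eigenvalue. -/
theorem isLargestAdjEigenvalue_of_pos [Nonempty V] (G : SimpleGraph V) {l : ℝ} (f : V → ℝ)
    (hf : ∀ v, 0 < f v) (h : ∀ v, G.adjSum f v = l * f v) : IsLargestAdjEigenvalue G l := by
  classical
  constructor
  · refine (G.hasEigenvalue_adjMatrix_iff l).2 ⟨f, ?_, h⟩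
    intro h0
    have := hf (Classical.arbitrary V)
    simp [h0] at this
  · intro μ hμ
    obtain ⟨g, hg, hgμ⟩ := (G.hasEigenvalue_adjMatrix_iff μ).1 hμ
    -- Comparison with `f`: at a vertex maximizing `|g| / f`, the eigenvalue equations of `g` and
    -- `f` give `μ ≤ l`.
    obtain ⟨v, -, hv⟩ := Finset.exists_max_image Finset.univ (fun v => |g v| / f v)
      Finset.univ_nonempty
    have hM : ∀ w, |g w| ≤ |g v| / f v * f w := fun w => by
      have := hv w (Finset.mem_univ w)
      exact (div_le_iff₀ (hf w)).1 this
    have hgv : 0 < |g v| := by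
      obtain ⟨w, hw⟩ := Function.ne_iff.1 hg
      by_contra hc
      have h0 : |g v| = 0 := le_antisymm (not_lt.1 hc) (abs_nonneg _)
      have := hM w
      rw [h0] at this
      simp only [zero_div, zero_mul] at this
      exact hw (abs_nonpos_iff.1 this)
    have h1 : μ * |g v| ≤ l * |g v| := by
      calc μ * |g v| ≤ |μ * g v| := by
            rw [abs_mul]; exact mul_le_mul_of_nonneg_right (le_abs_self μ) (abs_nonneg _)
        _ = |G.adjSum g v| := by rw [hgμ]
        _ ≤ ∑ w, |if G.Adj v w then g w else 0| := Finset.abs_sum_le_sum_abs _ _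
        _ ≤ ∑ w, |g v| / f v * (if G.Adj v w then f w else 0) := by
            refine Finset.sum_le_sum fun w _ => ?_
            split_ifs
            · exact hM w
            · simp
        _ = |g v| / f v * (l * f v) := by
            rw [← Finset.mul_sum, ← h v]; rfl
        _ = l * |g v| := by field_simp [(hf v).ne']
    exact le_of_mul_le_mul_right h1 hgv

/-- The largest eigenvalue of a graph has a nonnegative eigenvector. -/
theorem IsLargestAdjEigenvalue.exists_nonneg {G : SimpleGraph V} {l : ℝ}
    (h : IsLargestAdjEigenvalue G l) :
    ∃ f : V → ℝ, f ≠ 0 ∧ (∀ v, 0 ≤ f v) ∧ ∀ v, G.adjSum f v = l * f v := by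
  classical
  obtain ⟨h1, h2⟩ := h
  obtain ⟨g, hg, hgl⟩ := (G.hasEigenvalue_adjMatrix_iff l).1 h1
  set A : Matrix V V ℝ := G.adjMatrix ℝ with hA
  have hmul : ∀ f : V → ℝ, (l • (1 : Matrix V V ℝ) - A).mulVec f = l • f - G.adjSum f := by
    intro f
    rw [Matrix.sub_mulVec, Matrix.smul_mulVec, Matrix.one_mulVec, hA]
    congr 1
    convert G.adjMatrix_mulVec_eq_adjSum f
  have hherm : (l • (1 : Matrix V V ℝ) - A).IsHermitian := by
    have : A.IsHermitian := by
      ext i j; simp [hA, SimpleGraph.adjMatrix_apply, G.adj_comm]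
    refine Matrix.IsHermitian.sub ?_ this
    ext i j
    simp [Matrix.one_apply, eq_comm]
  have hpsd : (l • (1 : Matrix V V ℝ) - A).PosSemidef := by
    rw [hherm.posSemidef_iff_eigenvalues_nonneg]
    intro i
    have h3 := hherm.mulVec_eigenvectorBasis i
    rw [hmul] at h3
    -- An eigenvalue `t` of `l - A` gives the eigenvalue `l - t` of `A`, and `l` is the largest of
    -- these.
    have h4 : l - hherm.eigenvalues i ≤ l := by
      refine h2 ?_
      simp only [Set.mem_ofPred_eq]
      have := (G.hasEigenvalue_adjMatrix_iff (l - hherm.eigenvalues i)).2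
        ⟨(hherm.eigenvectorBasis i).ofLp, ?_, ?_⟩
      · convert this
      · intro h0
        exact hherm.eigenvectorBasis.orthonormal.ne_zero i (by ext v; exact congrFun h0 v)
      · intro v
        have := congrFun h3 v
        simp only [Pi.sub_apply, Pi.smul_apply, smul_eq_mul] at this
        linarith
    simp only [Pi.zero_apply]
    linarith
  have hdot : ∀ f : V → ℝ, star f ⬝ᵥ (l • (1 : Matrix V V ℝ) - A).mulVec f =
      ∑ v, (l * (f v * f v) - ∑ w, if G.Adj v w then f v * f w else 0) := by
    intro f
    rw [hmul]
    simp only [dotProduct, SimpleGraph.adjSum, Pi.sub_apply, Pi.smul_apply, smul_eq_mul, star_trivial]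
    refine Finset.sum_congr rfl fun v _ => ?_
    rw [mul_sub, Finset.mul_sum]
    congr 1
    · ring
    · exact Finset.sum_congr rfl fun w _ => by split_ifs <;> simp
  -- Replacing `g` by `|g|` does not increase the quadratic form of `l - A`, which vanishes at `g`.
  -- By semidefiniteness it vanishes at `|g|` too, so `|g|` lies in the kernel.
  have habs : star (fun v => |g v|) ⬝ᵥ (l • (1 : Matrix V V ℝ) - A).mulVec (fun v => |g v|) ≤ 0 := by
    have h0 : star g ⬝ᵥ (l • (1 : Matrix V V ℝ) - A).mulVec g = 0 := by
      rw [hmul]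
      have : l • g - G.adjSum g = 0 := by
        ext v; simp [hgl v]
      simp [this]
    rw [← h0, hdot, hdot]
    refine Finset.sum_le_sum fun v _ => ?_
    rw [abs_mul_abs_self]
    refine sub_le_sub_left (Finset.sum_le_sum fun w _ => ?_) _
    split_ifs
    · rw [← abs_mul]; exact le_abs_self _
    · exact le_rfl
  have hz := (hpsd.dotProduct_mulVec_zero_iff (fun v => |g v|)).1
    (le_antisymm habs (hpsd.dotProduct_mulVec_nonneg _))
  rw [hmul] at hz
  refine ⟨fun v => |g v|, ?_, fun v => abs_nonneg _, fun v => ?_⟩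
  · intro h0
    apply hg
    ext v
    exact abs_eq_zero.1 (congrFun h0 v)
  · have := congrFun hz v
    simp only [Pi.sub_apply, Pi.smul_apply, smul_eq_mul, Pi.zero_apply] at this
    linarith

/-- A positive eigenvector of a graph on any finite vertex type gives a graph on `Fin n`. -/
theorem isLargestAdjEigenvalueOfSomeGraph_of_pos [Nonempty V] (G : SimpleGraph V) {l : ℝ}
    (f : V → ℝ) (hf : ∀ v, 0 < f v) (h : ∀ v, G.adjSum f v = l * f v) :
    IsLargestAdjEigenvalueOfSomeGraph l := by
  classical
  let e := Fintype.equivFin V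
  have : Nonempty (Fin (Fintype.card V)) := ⟨e (Classical.arbitrary V)⟩
  refine ⟨Fintype.card V, G.comap e.symm, isLargestAdjEigenvalue_of_pos _ (f ∘ e.symm)
    (fun v => hf _) fun v => ?_⟩
  rw [Function.comp_apply, ← h]
  unfold SimpleGraph.adjSum
  rw [← Equiv.sum_comp e.symm]
  refine Finset.sum_congr rfl fun w _ => ?_
  simp

end Perron

/-! ### Perron vectors of the trees `T_{a,b,c}` -/

section Tripod

/-- The sequence `0, 1, l, l ^ 2 - 1, …` satisfying `u (n + 2) = l * u (n + 1) - u n`. -/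
noncomputable def pathSeq (l : ℝ) : ℕ → ℝ
  | 0 => 0
  | 1 => 1
  | n + 2 => l * pathSeq l (n + 1) - pathSeq l n

theorem pathSeq_lt_succ {l : ℝ} (hl : 2 ≤ l) (n : ℕ) :
    0 ≤ pathSeq l n ∧ pathSeq l n < pathSeq l (n + 1) := by
  induction n with
  | zero => simp [pathSeq]
  | succ n ih =>
    obtain ⟨h0, h1⟩ := ih
    refine ⟨h0.trans h1.le, ?_⟩
    rw [pathSeq]
    nlinarith

theorem pathSeq_pos {l : ℝ} (hl : 2 ≤ l) {n : ℕ} (hn : 0 < n) : 0 < pathSeq l n := by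
  obtain ⟨m, rfl⟩ := Nat.exists_eq_succ_of_ne_zero hn.ne'
  exact (pathSeq_lt_succ hl m).1.trans_lt (pathSeq_lt_succ hl m).2

/-- An arm with `m` vertices carries `u m, …, u 1` from the centre outwards. The separate term is
the contribution of the centre, with value `u (m + 1)`, to the first vertex; `u 0 = 0` stands for
the missing vertex beyond the tip. -/
theorem sum_path_adj (u : ℕ → ℝ) (h0 : u 0 = 0) (m : ℕ) (i : Fin m) :
    (∑ j : Fin m, if i.val + 1 = j.val ∨ j.val + 1 = i.val then u (m - j.val) else 0)
      + (if i.val = 0 then u (m + 1) else 0) = u (m - i.val - 1) + u (m - i.val + 1) := by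
  have h1 : ∀ j : Fin m, (if i.val + 1 = j.val ∨ j.val + 1 = i.val then u (m - j.val) else 0) =
      (if j.val = i.val + 1 then u (m - j.val) else 0) +
      (if j.val + 1 = i.val then u (m - j.val) else 0) := by
    intro j
    by_cases hj : j.val = i.val + 1
    · have : ¬ j.val + 1 = i.val := by omega
      simp [hj]
      omega
    · have : ¬ i.val + 1 = j.val := by omega
      simp [hj, this]
  rw [Finset.sum_congr rfl fun j _ => h1 j, Finset.sum_add_distrib]
  have h2 : (∑ j : Fin m, if j.val = i.val + 1 then u (m - j.val) else 0) = u (m - i.val - 1) := by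
    by_cases hi : i.val + 1 < m
    · rw [Finset.sum_eq_single (⟨i.val + 1, hi⟩ : Fin m)]
      · simp [Nat.sub_sub]
      · intro j _ hj
        rw [if_neg]
        exact fun h => hj (Fin.ext h)
      · simp
    · rw [Finset.sum_eq_zero]
      · have : m - i.val - 1 = 0 := by omega
        rw [this, h0]
      · intro j _
        rw [if_neg]
        have := j.isLt
        omega
  have h3 : (∑ j : Fin m, if j.val + 1 = i.val then u (m - j.val) else 0)
      + (if i.val = 0 then u (m + 1) else 0) = u (m - i.val + 1) := by
    by_cases hi : i.val = 0
    · simp [hi]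
    · have hlt : i.val - 1 < m := by omega
      rw [Finset.sum_eq_single (⟨i.val - 1, hlt⟩ : Fin m)]
      · have e1 : i.val - 1 + 1 = i.val := by omega
        have e2 : m - (i.val - 1) = m - i.val + 1 := by omega
        simp [hi, e1, e2]
      · intro j _ hj
        rw [if_neg]
        exact fun h => hj (Fin.ext (by simp; omega))
      · simp
  rw [h2, add_assoc, h3]

theorem sum_path_start (u : ℕ → ℝ) (h0 : u 0 = 0) (m : ℕ) :
    (∑ j : Fin m, if j.val = 0 then u (m - j.val) else 0) = u m := by
  cases m with
  | zero => simp [h0]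
  | succ m => simp

variable {a b c : ℕ}

theorem tripodStep_ne {v w : TripodVertex a b c} (h : TripodStep v w) : v ≠ w := by
  rintro rfl
  rcases v with _ | i | i | i <;> simp [TripodStep] at h

theorem tripodTree_adj (v w : TripodVertex a b c) :
    (tripodTree a b c).Adj v w ↔ TripodStep v w ∨ TripodStep w v := by
  rw [tripodTree, SimpleGraph.fromRel_adj]
  refine ⟨fun h => h.2, fun h => ⟨?_, h⟩⟩
  rcases h with h | h
  · exact tripodStep_ne h
  · exact (tripodStep_ne h).symm

/-- The vector on `T_{a,b,c}` built from `pathSeq` along the three arms. -/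
noncomputable def tripodVector (l : ℝ) (a b c : ℕ) : TripodVertex a b c → ℝ
  | none => pathSeq l a * pathSeq l b * pathSeq l c
  | some (.inl i) => pathSeq l (a - 1 - i.val) * (pathSeq l b * pathSeq l c)
  | some (.inr (.inl i)) => pathSeq l (b - 1 - i.val) * (pathSeq l a * pathSeq l c)
  | some (.inr (.inr i)) => pathSeq l (c - 1 - i.val) * (pathSeq l a * pathSeq l b)

theorem tripodVector_pos {l : ℝ} (hl : 2 ≤ l) (ha : 0 < a) (hb : 0 < b) (hc : 0 < c)
    (v : TripodVertex a b c) : 0 < tripodVector l a b c v := by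
  have h1 := pathSeq_pos hl ha
  have h2 := pathSeq_pos hl hb
  have h3 := pathSeq_pos hl hc
  have key : ∀ (m : ℕ) (i : Fin m), 0 < pathSeq l (m - i.val) := fun m i =>
    pathSeq_pos hl (by have := i.isLt; omega)
  rcases v with _ | i | i | i
  · simp only [tripodVector]; positivity
  all_goals
    simp only [tripodVector]
    have := key _ i
    positivity

theorem pathSeq_arm (l : ℝ) (m : ℕ) (i : Fin m) :
    pathSeq l (m - i.val - 1) + pathSeq l (m - i.val + 1) = l * pathSeq l (m - i.val) := by
  obtain ⟨k, hk⟩ : ∃ k, m - i.val = k + 1 := ⟨m - i.val - 1, by have := i.isLt; omega⟩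
  rw [hk]
  simp only [pathSeq, Nat.add_sub_cancel]
  ring

theorem tripod_arm_eq (l : ℝ) (m : ℕ) (hm : 0 < m) (i : Fin (m - 1)) (K : ℝ) :
    (if i.val = 0 then pathSeq l m * K else 0) +
      (∑ j : Fin (m - 1), if i.val + 1 = j.val ∨ j.val + 1 = i.val then
        pathSeq l (m - 1 - j.val) * K else 0) = l * (pathSeq l (m - 1 - i.val) * K) := by
  have h := sum_path_adj (pathSeq l) rfl (m - 1) i
  rw [pathSeq_arm, Nat.sub_add_cancel hm] at h
  have h1 : ∀ (p : Prop) [Decidable p] (x : ℝ), (if p then x * K else 0) =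
      (if p then x else 0) * K := fun p _ x => by split_ifs <;> simp
  simp only [h1]
  rw [← Finset.sum_mul, ← add_mul, add_comm, h]
  ring

/-- The Perron vector of `T_{a,b,c}`: only the equation at the centre has to be checked. -/
theorem tripodVector_eigen {l : ℝ} (ha : 0 < a) (hb : 0 < b) (hc : 0 < c)
    (h : pathSeq l (a - 1) * (pathSeq l b * pathSeq l c) +
      (pathSeq l (b - 1) * (pathSeq l a * pathSeq l c) +
        pathSeq l (c - 1) * (pathSeq l a * pathSeq l b)) =
      l * (pathSeq l a * pathSeq l b * pathSeq l c)) (v : TripodVertex a b c) :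
    (tripodTree a b c).adjSum (tripodVector l a b c) v = l * tripodVector l a b c v := by
  have h1 : ∀ (p : Prop) [Decidable p] (x K : ℝ), (if p then x * K else 0) =
      (if p then x else 0) * K := fun p _ x K => by split_ifs <;> simp
  classical
  have h2 : (tripodTree a b c).adjSum (tripodVector l a b c) v =
      ∑ w, if TripodStep v w ∨ TripodStep w v then tripodVector l a b c w else 0 := by
    refine Finset.sum_congr rfl fun w _ => ?_
    exact if_congr (tripodTree_adj v w) rfl rfl
  rw [h2, Fintype.sum_option, Fintype.sum_sum_type, Fintype.sum_sum_type]
  rcases v with _ | i | i | i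
  · simp only [TripodStep, tripodVector, or_false, if_false, zero_add]
    simp only [h1]
    rw [← Finset.sum_mul, ← Finset.sum_mul, ← Finset.sum_mul]
    rw [← h]
    congr 2
    · exact sum_path_start _ rfl _
    · congr 2
      exact sum_path_start _ rfl _
    · congr 2
      exact sum_path_start _ rfl _
  · simp only [TripodStep, tripodVector, or_false, false_or, if_false, Finset.sum_const_zero,
      add_zero]
    rw [← tripod_arm_eq l a ha i]
    exact congrArg₂ _ (if_congr Iff.rfl (by ring) rfl)
      (Finset.sum_congr rfl fun j _ => by congr)
  · simp only [TripodStep, tripodVector, or_false, false_or, if_false, Finset.sum_const_zero,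
      add_zero, zero_add]
    rw [← tripod_arm_eq l b hb i]
    exact congrArg₂ _ (if_congr Iff.rfl (by ring) rfl)
      (Finset.sum_congr rfl fun j _ => by congr)
  · simp only [TripodStep, tripodVector, or_false, false_or, if_false, Finset.sum_const_zero,
      zero_add]
    rw [← tripod_arm_eq l c hc i]
    exact congrArg₂ _ (if_congr Iff.rfl (by ring) rfl)
      (Finset.sum_congr rfl fun j _ => by congr)

end Tripod

/-! ### Trace polynomials and the equation at the centre -/

section TracePolynomials

/-- The polynomials `Q` with `P(z) = z ^ n * Q(z + 1 / z)` for the polynomials `P` of the six Salem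
numbers: `none` stands for `notPoly`, `some i` for `salemPoly i`. -/
noncomputable def tracePoly : Option (Fin 5) → ℤ[X]
  | none => X ^ 5 - 5 * X ^ 3 + 4 * X - 1
  | some i => ![X ^ 5 + X ^ 4 - 5 * X ^ 3 - 5 * X ^ 2 + 4 * X + 3,
      X ^ 5 - 5 * X ^ 3 - X ^ 2 + 5 * X + 1,
      X ^ 5 - 6 * X ^ 3 + 8 * X - 1,
      X ^ 4 - 4 * X ^ 2 - X + 1,
      X ^ 5 - 6 * X ^ 3 - X ^ 2 + 8 * X + 3] i

theorem aeval_tracePoly {A : Type*} [CommRing A] (x : A) :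
    aeval x (tracePoly none) = x ^ 5 - 5 * x ^ 3 + 4 * x - 1 ∧
    aeval x (tracePoly (some 0)) = x ^ 5 + x ^ 4 - 5 * x ^ 3 - 5 * x ^ 2 + 4 * x + 3 ∧
    aeval x (tracePoly (some 1)) = x ^ 5 - 5 * x ^ 3 - x ^ 2 + 5 * x + 1 ∧
    aeval x (tracePoly (some 2)) = x ^ 5 - 6 * x ^ 3 + 8 * x - 1 ∧
    aeval x (tracePoly (some 3)) = x ^ 4 - 4 * x ^ 2 - x + 1 ∧
    aeval x (tracePoly (some 4)) = x ^ 5 - 6 * x ^ 3 - x ^ 2 + 8 * x + 3 := by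
  have h (n : ℕ) [n.AtLeastTwo] : aeval x (OfNat.ofNat n : ℤ[X]) = OfNat.ofNat n :=
    map_ofNat (aeval x) n
  simp [tracePoly, h]

/-- Up to sign, the difference of the two sides is the trace polynomial at `l ^ 2 - 2` times a
cofactor in `l`; the cofactors are the coefficients in the `linear_combination` calls. -/
theorem tripod_two_three_center {l : ℝ} (i : Fin 5)
    (h : aeval (l ^ 2 - 2) (tracePoly (some i)) = 0) :
    pathSeq l (2 - 1) * (pathSeq l 3 * pathSeq l (6 + (i.val + 1))) +
      (pathSeq l (3 - 1) * (pathSeq l 2 * pathSeq l (6 + (i.val + 1))) +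
        pathSeq l (6 + (i.val + 1) - 1) * (pathSeq l 2 * pathSeq l 3)) =
      l * (pathSeq l 2 * pathSeq l 3 * pathSeq l (6 + (i.val + 1))) := by
  obtain ⟨-, h0, h1, h2, h3, h4⟩ := aeval_tracePoly (l ^ 2 - 2)
  fin_cases i <;> simp only [Nat.reduceAdd, Nat.reduceSub, pathSeq]
  · linear_combination (-1) * (h.symm.trans h0).symm
  · linear_combination (-l) * (h.symm.trans h1).symm
  · linear_combination (1 - l ^ 2) * (h.symm.trans h2).symm
  · linear_combination (-2 * l + 4 * l ^ 3 - l ^ 5) * (h.symm.trans h3).symm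
  · linear_combination (-1 + 3 * l ^ 2 - l ^ 4) * (h.symm.trans h4).symm

theorem tripod_two_four_center {l : ℝ} (h : aeval (l ^ 2 - 2) (tracePoly (some 3)) = 0) :
    pathSeq l (2 - 1) * (pathSeq l 4 * pathSeq l 5) +
      (pathSeq l (4 - 1) * (pathSeq l 2 * pathSeq l 5) +
        pathSeq l (5 - 1) * (pathSeq l 2 * pathSeq l 4)) =
      l * (pathSeq l 2 * pathSeq l 4 * pathSeq l 5) := by
  rw [(aeval_tracePoly (l ^ 2 - 2)).2.2.2.2.1] at h
  simp only [Nat.reduceSub, pathSeq]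
  linear_combination (-l) * h

end TracePolynomials

/-! ### Ratios of eigenvector entries towards pendant paths -/

section Exclusion

/-- The ratios of neighbouring entries, towards the end, of a positive eigenvector on a path that
hangs off a graph: `0, 1 / l, 1 / (l - 1 / l), …`. -/
noncomputable def armRatio (l : ℝ) : ℕ → ℝ
  | 0 => 0
  | n + 1 => 1 / (l - armRatio l n)

/-- The bound `0.95` is preserved by `t ↦ 1 / (l - t)` because `0.95 * (2.0095 - 0.95) > 1`. -/
theorem armRatio_bounds {l : ℝ} (hl : 2.0095 < l) (n : ℕ) :
    0 ≤ armRatio l n ∧ armRatio l n ≤ 0.95 := by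
  induction n with
  | zero => simp only [armRatio]; norm_num
  | succ n ih =>
    obtain ⟨h0, h1⟩ := ih
    have : (1.0595 : ℝ) < l - armRatio l n := by linarith
    rw [armRatio]
    refine ⟨by positivity, ?_⟩
    rw [div_le_iff₀ (by linarith)]
    linarith

variable {V : Type*} [Fintype V] {G : SimpleGraph V} {l : ℝ} {f : V → ℝ}

open Classical in
theorem SimpleGraph.adjSum_eq_sum_neighborFinset (G : SimpleGraph V) (f : V → ℝ) (v : V) :
    G.adjSum f v = ∑ w ∈ G.neighborFinset v, f w := by
  rw [SimpleGraph.adjSum, ← Finset.sum_filter]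
  refine Finset.sum_congr ?_ fun _ _ => rfl
  ext w
  simp

theorem le_mul_of_adj (hf : ∀ v, 0 ≤ f v) (h : ∀ v, G.adjSum f v = l * f v) {v w : V}
    (hvw : G.Adj v w) : f v ≤ l * f w := by
  classical
  rw [← h, G.adjSum_eq_sum_neighborFinset]
  exact Finset.single_le_sum (f := f) (fun u _ => hf u) (by simpa using hvw.symm)

theorem pos_of_adj (hl : 0 < l) (hf : ∀ v, 0 ≤ f v) (h : ∀ v, G.adjSum f v = l * f v) {v w : V}
    (hvw : G.Adj v w) (hv : 0 < f v) : 0 < f w :=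
  pos_of_mul_pos_right (hv.trans_le (le_mul_of_adj hf h hvw)) hl.le

/-- Looking from `v` at a neighbour `w`: either a path with `i ≤ n` vertices hangs off `v` at `w`,
or the entry at `w` is at least what a path with `n + 1` vertices would give. -/
theorem ratio_dichotomy (hl : 2.0095 < l) (hl' : l < 2.0097) (hf : ∀ v, 0 ≤ f v)
    (h : ∀ v, G.adjSum f v = l * f v) (n : ℕ) {v w : V} (hvw : G.Adj v w) (hv : 0 < f v) :
    (∃ i, 1 ≤ i ∧ i ≤ n ∧ f w = armRatio l i * f v) ∨ armRatio l (n + 1) * f v ≤ f w := by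
  classical
  have hl0 : 0 < l := by linarith
  induction n generalizing v w with
  | zero =>
    right
    have := le_mul_of_adj hf h hvw
    simp only [armRatio, sub_zero]
    rw [one_div, inv_mul_le_iff₀ hl0]
    exact this
  | succ n ih =>
    have hw : 0 < f w := pos_of_adj hl0 hf h hvw hv
    have hsum : f v + ∑ u ∈ (G.neighborFinset w).erase v, f u = l * f w := by
      rw [← h, G.adjSum_eq_sum_neighborFinset]
      exact Finset.add_sum_erase _ _ (by simpa using hvw.symm)
    set S := (G.neighborFinset w).erase v with hS
    have hadj : ∀ u ∈ S, G.Adj w u := by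
      intro u hu
      simpa using (Finset.mem_erase.1 hu).2
    rcases Nat.lt_or_ge 1 S.card with hc | hc
    -- If `w` has two further neighbours, each has entry at least `f w / l`, so `f v ≤ (l - 2 / l) *
    -- f w`. This makes the ratio at least about `0.98`, above every `armRatio`.
    · right
      obtain ⟨a, ha, b, hb, hab⟩ := Finset.one_lt_card.1 hc
      have h2 : f a + f b ≤ ∑ u ∈ S, f u := by
        rw [← Finset.sum_pair hab]
        exact Finset.sum_le_sum_of_subset_of_nonneg
          (by intro x hx; simp only [Finset.mem_insert, Finset.mem_singleton] at hx
              rcases hx with rfl | rfl <;> assumption) (fun u _ _ => hf u)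
      have h3 := le_mul_of_adj hf h (hadj a ha)
      have h4 := le_mul_of_adj hf h (hadj b hb)
      have h5 := (armRatio_bounds hl (n + 1 + 1)).2
      have h6 : armRatio l (n + 1 + 1) * f v ≤ 0.95 * f v := mul_le_mul_of_nonneg_right h5 hv.le
      have h7 : l * f a ≤ 2.0097 * f a := mul_le_mul_of_nonneg_right hl'.le (hf a)
      have h8 : l * f b ≤ 2.0097 * f b := mul_le_mul_of_nonneg_right hl'.le (hf b)
      have h9 : l * f w ≤ 2.0097 * f w := mul_le_mul_of_nonneg_right hl'.le hw.le
      linarith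
    · rcases Nat.lt_or_ge 0 S.card with hc' | hc'
      · obtain ⟨u, hu⟩ := Finset.card_eq_one.1 (le_antisymm hc hc')
        rw [hu, Finset.sum_singleton] at hsum
        have hwu : G.Adj w u := hadj u (by rw [hu]; simp)
        -- With a single further neighbour `u` of ratio `t = f u / f w`, the equation at `w` reads
        -- `f w = f v / (l - t)`. This is the recursion of `armRatio`, and it is increasing in `t`.
        rcases ih hwu hw with ⟨i, hi1, hi2, hi3⟩ | hi
        · left
          refine ⟨i + 1, by omega, by omega, ?_⟩
          have hb := (armRatio_bounds hl i).2
          have : l - armRatio l i ≠ 0 := by intro h0; linarith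
          rw [armRatio]
          field_simp
          rw [hi3] at hsum
          linarith
        · right
          have hb := (armRatio_bounds hl (n + 1)).2
          have : 0 < l - armRatio l (n + 1) := by linarith
          rw [armRatio, one_div, inv_mul_le_iff₀ this]
          linarith
      · left
        refine ⟨1, le_rfl, by omega, ?_⟩
        have : S = ∅ := Finset.card_eq_zero.1 (Nat.le_zero.1 hc')
        rw [this, Finset.sum_empty] at hsum
        simp only [armRatio, sub_zero]
        field_simp
        linarith

end Exclusion

/-! ### No graph has largest eigenvalue in `(2.0095, 2.0097)` -/

section ExclusionEnd

theorem armRatio_succ_mem {l a b : ℝ} (hl : 2.0095 < l) (hl' : l < 2.0097) {n : ℕ}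
    (h : a ≤ armRatio l n ∧ armRatio l n ≤ b) (hb : b ≤ 1) {c d : ℝ}
    (hc : c * (2.0097 - a) ≤ 1) (hc0 : 0 ≤ c) (hd : 1 ≤ d * (2.0095 - b)) (hd0 : 0 ≤ d) :
    c ≤ armRatio l (n + 1) ∧ armRatio l (n + 1) ≤ d := by
  have h0 : 0 < l - armRatio l n := by linarith [h.2]
  rw [armRatio]
  constructor
  · rw [le_div_iff₀ h0]
    exact (mul_le_mul_of_nonneg_left (by linarith [h.1]) hc0).trans hc
  · rw [div_le_iff₀ h0]
    exact hd.trans (mul_le_mul_of_nonneg_left (by linarith [h.2]) hd0)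

theorem armRatio_values {l : ℝ} (hl : 2.0095 < l) (hl' : l < 2.0097) :
    (0.4975 ≤ armRatio l 1 ∧ armRatio l 1 ≤ 0.4977) ∧
    (0.661 ≤ armRatio l 2 ∧ armRatio l 2 ≤ 0.662) ∧
    (0.741 ≤ armRatio l 3 ∧ armRatio l 3 ≤ 0.743) ∧
    (0.788 ≤ armRatio l 4 ∧ armRatio l 4 ≤ 0.79) ∧
    (0.818 ≤ armRatio l 5 ∧ armRatio l 5 ≤ 0.821) ∧
    (0.839 ≤ armRatio l 6 ∧ armRatio l 6 ≤ 0.842) ∧ 0.854 ≤ armRatio l 7 := by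
  have h0 : (0 : ℝ) ≤ armRatio l 0 ∧ armRatio l 0 ≤ 0 := by simp [armRatio]
  have h1 : (0.4975 : ℝ) ≤ armRatio l 1 ∧ armRatio l 1 ≤ 0.4977 := by
    apply armRatio_succ_mem hl hl' h0 <;> norm_num
  have h2 : (0.661 : ℝ) ≤ armRatio l 2 ∧ armRatio l 2 ≤ 0.662 := by
    apply armRatio_succ_mem hl hl' h1 <;> norm_num
  have h3 : (0.741 : ℝ) ≤ armRatio l 3 ∧ armRatio l 3 ≤ 0.743 := by
    apply armRatio_succ_mem hl hl' h2 <;> norm_num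
  have h4 : (0.788 : ℝ) ≤ armRatio l 4 ∧ armRatio l 4 ≤ 0.79 := by
    apply armRatio_succ_mem hl hl' h3 <;> norm_num
  have h5 : (0.818 : ℝ) ≤ armRatio l 5 ∧ armRatio l 5 ≤ 0.821 := by
    apply armRatio_succ_mem hl hl' h4 <;> norm_num
  have h6 : (0.839 : ℝ) ≤ armRatio l 6 ∧ armRatio l 6 ≤ 0.842 := by
    apply armRatio_succ_mem hl hl' h5 <;> norm_num
  have h7 : (0.854 : ℝ) ≤ armRatio l 7 ∧ armRatio l 7 ≤ 1 := by
    apply armRatio_succ_mem hl hl' h6 <;> norm_num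
  exact ⟨h1, h2, h3, h4, h5, h6, h7.1⟩

/-- The smallest ratio must come from a path with one or two vertices, since three ratios of at
least `armRatio l 3` already exceed `l`. In each remaining case the last ratio would have to fall
strictly between consecutive values of `armRatio`, or the sum is too small or too large outright. -/
theorem three_ratios_sum_ne {l : ℝ} (hl : 2.0095 < l) (hl' : l < 2.0097) {x y z : ℝ}
    (hx : ∀ n, (∃ i, 1 ≤ i ∧ i ≤ n ∧ x = armRatio l i) ∨ armRatio l (n + 1) ≤ x)
    (hy : ∀ n, (∃ i, 1 ≤ i ∧ i ≤ n ∧ y = armRatio l i) ∨ armRatio l (n + 1) ≤ y)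
    (hz : ∀ n, (∃ i, 1 ≤ i ∧ i ≤ n ∧ z = armRatio l i) ∨ armRatio l (n + 1) ≤ z)
    (hxy : x ≤ y) (hyz : y ≤ z) (hz1 : z ≤ 1) : x + y + z ≠ l := by
  intro hs
  obtain ⟨⟨a1, b1⟩, ⟨a2, b2⟩, ⟨a3, b3⟩, ⟨a4, b4⟩, ⟨a5, b5⟩, ⟨a6, b6⟩, a7⟩ :=
    armRatio_values hl hl'
  rcases hx 2 with ⟨i, hi1, hi2, rfl⟩ | h
  · interval_cases i
    · rcases hy 3 with ⟨j, hj1, hj2, rfl⟩ | h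
      · interval_cases j
        · linarith
        -- Here `z` would be about `0.850`, between `armRatio l 6` and `armRatio l 7`. This is the
        -- gap between `T_{2,3,7}` and `T_{2,3,8}`.
        · rcases hz 6 with ⟨k, hk1, hk2, rfl⟩ | h
          · interval_cases k <;> linarith
          · norm_num at h
            linarith
        -- Here `z` would be about `0.770`, between `armRatio l 3` and `armRatio l 4`.
        · rcases hz 3 with ⟨k, hk1, hk2, rfl⟩ | h
          · interval_cases k <;> linarith
          · norm_num at h
            linarith
      · norm_num at h
        linarith
    · rcases hz 2 with ⟨k, hk1, hk2, rfl⟩ | h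
      · interval_cases k <;> linarith
      · norm_num at h
        linarith
  · norm_num at h
    linarith

variable {V : Type*} [Fintype V] {G : SimpleGraph V} {l : ℝ}

/-- No graph has its largest eigenvalue between those of `T_{2,3,7}` and `T_{2,3,8}`, as far as
the interval `(2.0095, 2.0097)` is concerned. -/
theorem not_isLargestAdjEigenvalue (hl : 2.0095 < l) (hl' : l < 2.0097) :
    ¬ IsLargestAdjEigenvalue G l := by
  classical
  intro hG
  obtain ⟨f, hf0, hf, h⟩ := hG.exists_nonneg
  obtain ⟨v0, hv0⟩ := Function.ne_iff.1 hf0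
  obtain ⟨v, -, hv⟩ := Finset.exists_max_image Finset.univ f ⟨v0, Finset.mem_univ v0⟩
  have hpos : 0 < f v :=
    ((hf v0).lt_of_ne (Ne.symm hv0)).trans_le (hv v0 (Finset.mem_univ _))
  set N := G.neighborFinset v with hN
  let x : V → ℝ := fun w => f w / f v
  have hsum : ∑ w ∈ N, x w = l := by
    rw [← Finset.sum_div, ← G.adjSum_eq_sum_neighborFinset, h]
    field_simp
  have hx1 : ∀ w, x w ≤ 1 := fun w => (div_le_one hpos).2 (hv w (Finset.mem_univ _))
  have hR : ∀ w ∈ N, ∀ n, (∃ i, 1 ≤ i ∧ i ≤ n ∧ x w = armRatio l i) ∨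
      armRatio l (n + 1) ≤ x w := by
    intro w hw n
    rcases ratio_dichotomy hl hl' hf h n (by simpa [hN] using hw) hpos with ⟨i, h1, h2, h3⟩ | h1
    · exact Or.inl ⟨i, h1, h2, (div_eq_iff hpos.ne').2 h3⟩
    · exact Or.inr ((le_div_iff₀ hpos).2 h1)
  obtain ⟨⟨a1, b1⟩, ⟨a2, b2⟩, -⟩ := armRatio_values hl hl'
  have hlow : ∀ w ∈ N, armRatio l 1 ≤ x w := by
    intro w hw
    rcases hR w hw 0 with ⟨i, h1, h2, -⟩ | h1
    · omega
    · exact h1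
  -- Every ratio lies in `[0.4975, 1]` and the ratios sum to `l`, so the vertex `v` has degree 3 or
  -- 4.
  have hc1 : (N.card : ℝ) * 0.4975 ≤ l := by
    rw [← hsum, ← nsmul_eq_mul]
    exact Finset.card_nsmul_le_sum _ _ _ fun w hw => a1.trans (hlow w hw)
  have hc2 : l ≤ (N.card : ℝ) := by
    rw [← hsum, ← mul_one (N.card : ℝ), ← nsmul_eq_mul]
    exact Finset.sum_le_card_nsmul _ _ _ fun w _ => hx1 w
  have hc3 : 2 < N.card := by
    have : (2 : ℝ) < N.card := by linarith
    exact_mod_cast this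
  have hc4 : N.card < 5 := by
    have : (N.card : ℝ) < 5 := by linarith
    exact_mod_cast this
  obtain hc | hc : N.card = 3 ∨ N.card = 4 := by omega
  · obtain ⟨a, b, c, hab, hac, hbc, hS⟩ := Finset.card_eq_three.1 hc
    have hs : x a + x b + x c = l := by
      rw [← hsum, hS, Finset.sum_insert (by simp [hab, hac]), Finset.sum_pair hbc, add_assoc]
    have ha := hR a (by simp [hS])
    have hb := hR b (by simp [hS])
    have hc := hR c (by simp [hS])
    rcases le_total (x a) (x b) with h1 | h1 <;> rcases le_total (x b) (x c) with h2 | h2 <;>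
      rcases le_total (x a) (x c) with h3 | h3
    · exact three_ratios_sum_ne hl hl' ha hb hc h1 h2 (hx1 _) hs
    · exact three_ratios_sum_ne hl hl' ha hb hc h1 h2 (hx1 _) hs
    · exact three_ratios_sum_ne hl hl' ha hc hb h3 h2 (hx1 _) (by linarith)
    · exact three_ratios_sum_ne hl hl' hc ha hb h3 h1 (hx1 _) (by linarith)
    · exact three_ratios_sum_ne hl hl' hb ha hc h1 h3 (hx1 _) (by linarith)
    · exact three_ratios_sum_ne hl hl' hb hc ha h2 h3 (hx1 _) (by linarith)
    · exact three_ratios_sum_ne hl hl' hc hb ha h2 h1 (hx1 _) (by linarith)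
    · exact three_ratios_sum_ne hl hl' hc hb ha h2 h1 (hx1 _) (by linarith)
  -- Degree 4: four leaves give a sum below `2`, while a single neighbour that is not a leaf already
  -- gives more than `2.15`.
  · by_cases hall : ∀ w ∈ N, x w = armRatio l 1
    · rw [Finset.sum_congr rfl hall, Finset.sum_const, hc] at hsum
      simp only [nsmul_eq_mul, Nat.cast_ofNat] at hsum
      linarith
    · push Not at hall
      obtain ⟨w, hw, hne⟩ := hall
      have hw2 : armRatio l 2 ≤ x w := by
        rcases hR w hw 1 with ⟨i, h1, h2, h3⟩ | h1
        · obtain rfl : i = 1 := by omega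
          exact absurd h3 hne
        · exact h1
      rw [← Finset.add_sum_erase N x hw] at hsum
      have h3 : ((N.erase w).card : ℝ) * 0.4975 ≤ ∑ u ∈ N.erase w, x u := by
        rw [← nsmul_eq_mul]
        exact Finset.card_nsmul_le_sum _ _ _ fun u hu =>
          a1.trans (hlow u (Finset.mem_of_mem_erase hu))
      rw [Finset.card_erase_of_mem hw, hc] at h3
      norm_num at h3
      linarith

end ExclusionEnd

/-! ### Conjugates of `α` and of `α + α⁻¹` -/

section Trace

open IntermediateField

theorem exists_algHom_gen_eq {α : ℝ} (hα : IsIntegral ℚ α) {z : ℂ}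
    (hz : aeval z (minpoly ℚ α) = 0) :
    ∃ ψ : ℚ⟮α⟯ →ₐ[ℚ] ℂ, ψ (AdjoinSimple.gen ℚ α) = z :=
  ⟨(algHomAdjoinIntegralEquiv ℚ hα).symm ⟨z, (mem_aroots).2 ⟨minpoly.ne_zero hα, hz⟩⟩,
    algHomAdjoinIntegralEquiv_symm_apply_gen ℚ hα _⟩

/-- Both values are images of one element of `ℚ⟮α⟯` under field embeddings, one into `ℂ` and one
into `ℝ`, and embeddings are injective. -/
theorem aeval_inv_eq_zero_iff {α : ℝ} (hα : IsIntegral ℚ α) {z : ℂ}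
    (hz : aeval z (minpoly ℚ α) = 0) (g : ℚ[X]) : aeval z⁻¹ g = 0 ↔ aeval α⁻¹ g = 0 := by
  obtain ⟨ψ, hψ⟩ := exists_algHom_gen_eq hα hz
  have h1 : aeval z⁻¹ g = ψ (aeval (AdjoinSimple.gen ℚ α)⁻¹ g) := by
    rw [← aeval_algHom_apply, map_inv₀, hψ]
  have h2 : aeval α⁻¹ g = ℚ⟮α⟯.val (aeval (AdjoinSimple.gen ℚ α)⁻¹ g) := by
    rw [← aeval_algHom_apply, map_inv₀]; simp
  rw [h1, h2, map_eq_zero ψ, map_eq_zero ℚ⟮α⟯.val]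

theorem aeval_add_inv_eq_zero_iff {α : ℝ} (hα : IsIntegral ℚ α) {z : ℂ}
    (hz : aeval z (minpoly ℚ α) = 0) (g : ℚ[X]) :
    aeval (z + z⁻¹) g = 0 ↔ aeval (α + α⁻¹) g = 0 := by
  obtain ⟨ψ, hψ⟩ := exists_algHom_gen_eq hα hz
  set γ := AdjoinSimple.gen ℚ α with hγ
  have h1 : aeval (z + z⁻¹) g = ψ (aeval (γ + γ⁻¹) g) := by
    rw [← aeval_algHom_apply, map_add, map_inv₀, hψ]
  have h2 : aeval (α + α⁻¹) g = ℚ⟮α⟯.val (aeval (γ + γ⁻¹) g) := by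
    rw [← aeval_algHom_apply, map_add, map_inv₀]; simp [hγ]
  rw [h1, h2, map_eq_zero ψ, map_eq_zero ℚ⟮α⟯.val]

/-- The conjugates of `γ + γ⁻¹` are its images under the embeddings of `ℚ⟮α⟯` into `ℂ`; the image of
`γ` under the same embedding is the required `z`. -/
theorem exists_root_add_inv_eq {α : ℝ} (hα : IsIntegral ℚ α) {w : ℂ}
    (hw : aeval w (minpoly ℚ (α + α⁻¹)) = 0) :
    ∃ z : ℂ, aeval z (minpoly ℚ α) = 0 ∧ z + z⁻¹ = w := by
  set γ := AdjoinSimple.gen ℚ α with hγ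
  have : FiniteDimensional ℚ ℚ⟮α⟯ := adjoin.finiteDimensional hα
  have h1 : minpoly ℚ (α + α⁻¹) = minpoly ℚ (γ + γ⁻¹) := by
    have h := minpoly.algHom_eq ℚ⟮α⟯.val ℚ⟮α⟯.val.injective (γ + γ⁻¹)
    rw [map_add, map_inv₀] at h
    simp only [IntermediateField.coe_val, AdjoinSimple.coe_gen, hγ] at h ⊢
    convert h
    exact Subsingleton.elim _ _
  have h2 : w ∈ (minpoly ℚ (γ + γ⁻¹)).rootSet ℂ := by
    rw [mem_rootSet, ← h1]
    refine ⟨?_, hw⟩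
    rw [h1]
    exact minpoly.ne_zero (Algebra.IsIntegral.isIntegral _)
  rw [← Algebra.IsAlgebraic.range_eval_eq_rootSet_minpoly] at h2
  obtain ⟨ψ, rfl⟩ := h2
  refine ⟨ψ γ, ?_, by simp⟩
  have h3 : minpoly ℚ α = minpoly ℚ γ := by
    have h := minpoly.algHom_eq ℚ⟮α⟯.val ℚ⟮α⟯.val.injective γ
    simp only [IntermediateField.coe_val, AdjoinSimple.coe_gen, hγ] at h ⊢
    convert h
    exact Subsingleton.elim _ _
  rw [h3, aeval_algHom_apply, minpoly.aeval, map_zero]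

theorem inv_eq_star_of_norm_eq_one {z : ℂ} (hz : ‖z‖ = 1) : z⁻¹ = starRingEnd ℂ z := by
  rw [Complex.inv_def, Complex.normSq_eq_norm_sq, hz]
  simp

theorem aeval_conj_eq_zero {z : ℂ} {g : ℚ[X]} (h : aeval z g = 0) :
    aeval (starRingEnd ℂ z) g = 0 := by
  have := aeval_algHom_apply ((Complex.conjAe : ℂ →ₐ[ℝ] ℂ).restrictScalars ℚ) z g
  rw [h, map_zero] at this
  exact this

/-- An irreducible polynomial with a rational root is linear. -/
theorem eq_of_aeval_rat_eq_zero {α : ℝ} (hα : IsIntegral ℚ α) {q : ℚ}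
    (hq : aeval (q : ℂ) (minpoly ℚ α) = 0) : α = q := by
  have h0 : (minpoly ℚ α).IsRoot q := by
    have h2 : algebraMap ℚ ℂ ((minpoly ℚ α).eval q) = 0 := by
      rw [← aeval_algebraMap_apply_eq_algebraMap_eval]; simpa using hq
    simpa using h2
  obtain ⟨r, hr⟩ := minpoly.mem_range_of_degree_eq_one ℚ α
    (degree_eq_one_of_irreducible_of_root (minpoly.irreducible hα) h0)
  have h4 : minpoly ℚ α = X - C r := by rw [← hr]; exact minpoly.eq_X_sub_C ℝ r
  rw [h4] at h0
  have : q = r := by simpa [sub_eq_zero] using h0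
  rw [← hr, this]; simp

/-- The map `z ↦ z + z⁻¹` sends the conjugates of `α` onto a set containing those of `α + α⁻¹`. Each
fibre contains `z` and `z⁻¹`, which differ because `z = ±1` would force `α = ±1`. -/
theorem natDegree_minpoly_add_inv {α : ℝ} (hα : IsIntegral ℚ α) (h1 : 1 < α)
    (hinv : aeval α⁻¹ (minpoly ℚ α) = 0) :
    2 * (minpoly ℚ (α + α⁻¹)).natDegree ≤ (minpoly ℚ α).natDegree := by
  classical
  have hα0 : α ≠ 0 := by linarith
  have hβ : IsIntegral ℚ (α + α⁻¹) := hα.add hα.inv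
  have hcard : ∀ x : ℝ, IsIntegral ℚ x →
      ((minpoly ℚ x).rootSet ℂ).toFinset.card = (minpoly ℚ x).natDegree := by
    intro x hx
    rw [Set.toFinset_card]
    exact card_rootSet_eq_natDegree (minpoly.irreducible hx).separable (IsAlgClosed.splits _)
  rw [← hcard _ hα, ← hcard _ hβ, mul_comm]
  have hmem : ∀ z : ℂ, z ∈ ((minpoly ℚ α).rootSet ℂ).toFinset ↔ aeval z (minpoly ℚ α) = 0 := by
    intro z
    rw [Set.mem_toFinset, mem_rootSet_of_ne (minpoly.ne_zero hα)]
  have hsub : ((minpoly ℚ (α + α⁻¹)).rootSet ℂ).toFinset ⊆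
      ((minpoly ℚ α).rootSet ℂ).toFinset.image fun z => z + z⁻¹ := by
    intro w hw
    rw [Set.mem_toFinset, mem_rootSet_of_ne (minpoly.ne_zero hβ)] at hw
    obtain ⟨z, hz, hzw⟩ := exists_root_add_inv_eq hα hw
    exact Finset.mem_image.2 ⟨z, (hmem z).2 hz, hzw⟩
  refine (Nat.mul_le_mul_right 2 (Finset.card_le_card hsub)).trans ?_
  rw [mul_comm]
  refine Finset.mul_card_image_le_card _ 2 fun w hw => ?_
  obtain ⟨z, hz, rfl⟩ := Finset.mem_image.1 hw
  have hz' := (hmem z).1 hz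
  have hzi : aeval z⁻¹ (minpoly ℚ α) = 0 := (aeval_inv_eq_zero_iff hα hz' _).2 hinv
  have hz0 : z ≠ 0 := by
    rintro rfl
    have := eq_of_aeval_rat_eq_zero hα (q := 0) (by simpa using hz')
    simp at this
    linarith
  have hne : z ≠ z⁻¹ := by
    intro h
    have h2 : z * z = 1 := by
      nth_rewrite 2 [h]; exact mul_inv_cancel₀ hz0
    rcases mul_self_eq_one_iff.1 h2 with rfl | rfl
    · have := eq_of_aeval_rat_eq_zero hα (q := 1) (by simpa using hz')
      simp at this
      linarith
    · have := eq_of_aeval_rat_eq_zero hα (q := -1) (by simpa using hz')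
      simp at this
      linarith
  rw [← Finset.card_pair hne]
  refine Finset.card_le_card fun u hu => ?_
  simp only [Finset.mem_insert, Finset.mem_singleton] at hu
  rw [Finset.mem_filter]
  rcases hu with rfl | rfl
  · exact ⟨hz, rfl⟩
  · exact ⟨(hmem _).2 hzi, by rw [inv_inv, add_comm]⟩

end Trace

/-! ### The finite search for quintics -/

section FiniteSearch

/-- `p` holds at the `n` integers `lo, …, lo + n - 1`. -/
def intAll (lo : ℤ) (n : ℕ) (p : ℤ → Bool) : Bool :=
  (List.range n).all fun i => p (lo + i)

theorem of_intAll {lo : ℤ} {n : ℕ} {p : ℤ → Bool} (h : intAll lo n p = true) {x : ℤ}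
    (h1 : lo ≤ x) (h2 : x < lo + n) : p x = true := by
  rw [intAll, List.all_eq_true] at h
  have := h (x - lo).toNat (List.mem_range.2 (by omega))
  rwa [Int.toNat_of_nonneg (by omega), add_sub_cancel] at this

/-- Newton's inequalities at the half-integer `x / 2` for a quintic with the given coefficients. -/
def QuinticNewton (q4 q3 q2 q1 q0 x : ℤ) : Prop :=
  10 * ((x ^ 5 + 2 * q4 * x ^ 4 + 4 * q3 * x ^ 3 + 8 * q2 * x ^ 2 + 16 * q1 * x + 32 * q0) *
      (10 * x ^ 3 + 12 * q4 * x ^ 2 + 12 * q3 * x + 8 * q2)) ≤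
    4 * (5 * x ^ 4 + 8 * q4 * x ^ 3 + 12 * q3 * x ^ 2 + 16 * q2 * x + 16 * q1) ^ 2 ∧
  2 * ((5 * x ^ 4 + 8 * q4 * x ^ 3 + 12 * q3 * x ^ 2 + 16 * q2 * x + 16 * q1) *
      (10 * x ^ 2 + 8 * q4 * x + 4 * q3)) ≤
    (10 * x ^ 3 + 12 * q4 * x ^ 2 + 12 * q3 * x + 8 * q2) ^ 2

instance (q4 q3 q2 q1 q0 x : ℤ) : Decidable (QuinticNewton q4 q3 q2 q1 q0 x) :=
  inferInstanceAs (Decidable (_ ∧ _))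

/-- The quintics found by the search. -/
def quinticList : List (ℤ × ℤ × ℤ × ℤ × ℤ) :=
  [(1, -5, -5, 4, 3), (0, -5, -1, 5, 1), (0, -6, 0, 8, -1), (0, -6, -1, 8, 3), (0, -5, 0, 4, -1)]

/-- The part of the search that concerns the value `vn` at `-2`. -/
def quinticValues (vn v2 v1 v0 vm : ℤ) : Bool :=
  decide (0 ≤ vn ∨ 280 < -vn * -v2 ∨ 787 < -vn * (vm * vm) * (v1 * v1) * -v2 ∨
    312 < -vn * (v0 * v0) * -v2 ∨ 78400 < vn * vn * (vm * vm) * (v2 * v2 * (v2 * v2) * (v2 * v2)))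

/-- The part of the search that concerns the coefficients. -/
def quinticLeaf (q4 q3 q2 q1 q0 : ℤ) : Bool :=
  decide (¬ (0 < 80 - 32 * q4 + 12 * q3 - 4 * q2 + q1) ∨
    ¬ (0 < 207 ^ 5 + 207 ^ 4 * 100 * q4 + 207 ^ 3 * 100 ^ 2 * q3 + 207 ^ 2 * 100 ^ 3 * q2 +
      207 * 100 ^ 4 * q1 + 100 ^ 5 * q0) ∨
    ¬ QuinticNewton q4 q3 q2 q1 q0 (-4) ∨ ¬ QuinticNewton q4 q3 q2 q1 q0 (-3) ∨
    ¬ QuinticNewton q4 q3 q2 q1 q0 (-2) ∨ ¬ QuinticNewton q4 q3 q2 q1 q0 (-1) ∨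
    ¬ QuinticNewton q4 q3 q2 q1 q0 0 ∨ ¬ QuinticNewton q4 q3 q2 q1 q0 1 ∨
    ¬ QuinticNewton q4 q3 q2 q1 q0 2 ∨ ¬ QuinticNewton q4 q3 q2 q1 q0 3 ∨
    ¬ QuinticNewton q4 q3 q2 q1 q0 4 ∨ (q4, q3, q2, q1, q0) ∈ quinticList)

/-- The search for quintics, through the values at `2, -1, 1, 0` and the coefficient of `X ^ 4`. -/
def quinticSearch : Bool :=
  intAll (-6) 6 fun v2 => intAll (-12) 25 fun vm =>
    decide (vm = 0 ∨ 168 < vm * vm * -v2) || intAll (-28) 57 fun v1 =>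
    decide (v1 = 0 ∨ (v1 - vm) % 2 ≠ 0 ∨ 787 < vm * vm * (v1 * v1) * -v2) ||
    intAll (-17) 35 fun v0 =>
    decide (v0 = 0 ∨ (v2 - 30 - 3 * v1 - vm + 3 * v0) % 6 ≠ 0 ∨ 312 < v0 * v0 * -v2) ||
    -- Four values determine a monic quintic up to one parameter, taken to be `q4`. The fourth
    -- difference gives the value at `-2`, and interpolation gives `q3`, `q2`, `q1`; the congruences
    -- modulo 2 and 6 make the divisions exact.
    intAll (-10) 16 fun q4 =>
      quinticValues (24 * q4 - v2 + 4 * v1 + 4 * vm - 6 * v0) v2 v1 v0 vm ||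
      quinticLeaf q4 ((v2 - 30 - 3 * v1 - vm + 3 * v0) / 6 - 2 * q4)
        ((v1 + vm) / 2 - q4 - v0)
        ((v1 - vm) / 2 - 1 - (v2 - 30 - 3 * v1 - vm + 3 * v0) / 6 + 2 * q4) v0

set_option maxRecDepth 100000 in
theorem quinticSearch_eq_true : quinticSearch = true := by
  decide +kernel

end FiniteSearch

/-! ### The finite search for quartics -/

section QuarticSearch

/-- Newton's inequality at `x` for a quartic with the given coefficients. -/
def QuarticNewton (q3 q2 q1 q0 x : ℤ) : Prop :=
  8 * ((x ^ 4 + q3 * x ^ 3 + q2 * x ^ 2 + q1 * x + q0) * (6 * x ^ 2 + 3 * q3 * x + q2)) ≤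
    3 * (4 * x ^ 3 + 3 * q3 * x ^ 2 + 2 * q2 * x + q1) ^ 2

instance (q3 q2 q1 q0 x : ℤ) : Decidable (QuarticNewton q3 q2 q1 q0 x) :=
  inferInstanceAs (Decidable (_ ≤ _))

/-- The part of the search for quartics that concerns the value `vn` at `-2`. -/
def quarticValues (vn v2 v1 v0 vm : ℤ) : Bool :=
  decide (vn ≤ 0 ∨ 196 < vn * (vm * vm) * (v1 * v1) * -v2 ∨
    78 < vn * (v0 * v0) * -v2 ∨ 289 < vn * vn * (vm * vm) * (v2 * v2 * (v2 * v2) * (v2 * v2)))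

/-- The part of the search for quartics that concerns the coefficients. -/
def quarticLeaf (q3 q2 q1 q0 : ℤ) : Bool :=
  decide (¬ (0 < 207 ^ 4 + 207 ^ 3 * 100 * q3 + 207 ^ 2 * 100 ^ 2 * q2 + 207 * 100 ^ 3 * q1 +
      100 ^ 4 * q0) ∨
    ¬ QuarticNewton q3 q2 q1 q0 (-1) ∨ ¬ QuarticNewton q3 q2 q1 q0 0 ∨
    ¬ QuarticNewton q3 q2 q1 q0 1 ∨ (q3, q2, q1, q0) = (0, -4, -1, 1))

/-- The search for quartics, through the values at `2, -1, 1, 0`. -/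
def quarticSearch : Bool :=
  intAll (-2) 2 fun v2 => intAll (-6) 13 fun vm =>
    decide (vm = 0 ∨ 42 < vm * vm * -v2) || intAll (-14) 29 fun v1 =>
    decide (v1 = 0 ∨ (v1 - vm) % 2 ≠ 0 ∨ 196 < vm * vm * (v1 * v1) * -v2) ||
    intAll (-8) 17 fun v0 =>
    decide (v0 = 0 ∨ (v2 - 12 - 3 * v1 - vm + 3 * v0) % 6 ≠ 0 ∨ 78 < v0 * v0 * -v2) ||
      quarticValues (24 - v2 + 4 * v1 + 4 * vm - 6 * v0) v2 v1 v0 vm ||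
      quarticLeaf ((v2 - 12 - 3 * v1 - vm + 3 * v0) / 6) ((v1 + vm) / 2 - 1 - v0)
        ((v1 - vm) / 2 - (v2 - 12 - 3 * v1 - vm + 3 * v0) / 6) v0

set_option maxRecDepth 100000 in
theorem quarticSearch_eq_true : quarticSearch = true := by
  decide +kernel

end QuarticSearch

/-! ### Auxiliary functions on `(-2, 2)` and on `(2, 2.07)` -/

section RealBounds

/-- `(-2 - x) (-1 - x) (2 - x) ^ 3`. -/
noncomputable def boundA (x : ℝ) : ℝ := (-2 - x) * (-1 - x) * (2 - x) ^ 3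
/-- `(-2 - x) (-1 - x) ^ 2 (1 - x) ^ 2 (2 - x)`. -/
noncomputable def boundB (x : ℝ) : ℝ := (-2 - x) * (-1 - x) ^ 2 * (1 - x) ^ 2 * (2 - x)
/-- `(-2 - x) x ^ 2 (2 - x)`. -/
noncomputable def boundC (x : ℝ) : ℝ := (-2 - x) * (0 - x) ^ 2 * (2 - x)
/-- `(-1 - x) ^ 2 (2 - x)`. -/
noncomputable def boundD (x : ℝ) : ℝ := (-1 - x) ^ 2 * (2 - x)
/-- `(-2 - x) (2 - x) ^ 4`. -/
noncomputable def boundE (x : ℝ) : ℝ := (-2 - x) * (2 - x) ^ 4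

variable {x : ℝ}

/-- The maximum `16` is attained at `0`, so `x ^ 2` splits off from `16 - boundA x`. Only between
`-2` and `-1` is the function negative, and there `(x + 2) (x + 1) ≥ -1/4` and `(2 - x) ^ 3 ≤ 64`.
-/
theorem abs_boundA_le (h1 : -2 < x) (h2 : x < 2) : |boundA x| ≤ 16 := by
  rw [boundA, abs_le]
  constructor
  · by_cases hx : -1 ≤ x
    · have : 0 ≤ (x + 2) * (x + 1) * (2 - x) ^ 3 :=
        mul_nonneg (mul_nonneg (by linarith) (by linarith)) (pow_nonneg (by linarith) _)
      nlinarith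
    · have h3 : (2 - x) ^ 3 ≤ 4 ^ 3 := pow_le_pow_left₀ (by linarith) (by linarith) 3
      have h4 : 0 ≤ (2 - x) ^ 3 := pow_nonneg (by linarith) 3
      have h5 : -(1 / 4) ≤ (-2 - x) * (-1 - x) := by nlinarith [sq_nonneg (x + 3 / 2)]
      nlinarith
  · have h3 : 0 ≤ (x - 2) ^ 2 * (x + 2) := mul_nonneg (sq_nonneg _) (by linarith)
    have h4 : 0 ≤ x ^ 2 * ((x - 2) ^ 2 * (x + 2) - (x - 2) ^ 2 + 4 * (3 - x)) := by
      refine mul_nonneg (sq_nonneg _) ?_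
      nlinarith [sq_nonneg (x - 2)]
    nlinarith

/-- With `x = 2 cos θ` the absolute value is `4 sin² 3θ`: it equals `4 - (x ^ 3 - 3 x) ^ 2`.
Likewise `boundC` gives `4 sin² 2θ`, and `boundD x = 2 - 2 cos 3θ`. -/
theorem abs_boundB_le (h1 : -2 < x) (h2 : x < 2) : |boundB x| ≤ 4 := by
  have h0 : 0 < 4 - x ^ 2 := by nlinarith
  rw [boundB, abs_le]
  constructor
  · nlinarith [sq_nonneg (x * (x ^ 2 - 3))]
  · nlinarith [mul_nonneg h0.le (sq_nonneg (x ^ 2 - 1))]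

theorem abs_boundC_le (h1 : -2 < x) (h2 : x < 2) : |boundC x| ≤ 4 := by
  have h0 : 0 < 4 - x ^ 2 := by nlinarith
  rw [boundC, abs_le]
  constructor
  · nlinarith [sq_nonneg (x ^ 2 - 2)]
  · nlinarith [mul_nonneg h0.le (sq_nonneg x)]

theorem abs_boundD_le (h1 : -2 < x) (h2 : x < 2) : |boundD x| ≤ 4 := by
  rw [boundD, abs_le]
  constructor
  · nlinarith [mul_nonneg (sq_nonneg (-1 - x)) (sub_pos.2 h2).le]
  · nlinarith [mul_nonneg (sq_nonneg (x - 1)) (by linarith : 0 ≤ x + 2)]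

theorem abs_boundE_le (h1 : -2 < x) (h2 : x < 2) : |boundE x| ≤ 90 := by
  have h0 : 0 < 2 - x := by linarith
  rw [boundE, abs_le]
  constructor
  · have := mul_nonneg (sq_nonneg (2 - x - 3.2))
      (by positivity : 0 ≤ (2 - x) ^ 3 + 2.4 * (2 - x) ^ 2 + 5.12 * (2 - x) + 8.192)
    nlinarith
  · nlinarith [mul_nonneg (by linarith : 0 ≤ x + 2) (pow_nonneg h0.le 4)]

theorem abs_bounds_of_gt (h1 : 2 < x) (h2 : x < 2.07) :
    |boundA x| ≤ 4.07 * 3.07 * 0.07 ^ 3 ∧ |boundB x| ≤ 4.07 * 3.07 ^ 2 * 1.07 ^ 2 * 0.07 ∧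
    |boundC x| ≤ 4.07 * 2.07 ^ 2 * 0.07 ∧ |boundD x| ≤ 3.07 ^ 2 * 0.07 ∧
    |boundE x| ≤ 4.07 * 0.07 ^ 4 := by
  have e1 : |(-2 - x)| ≤ 4.07 := by rw [abs_le]; constructor <;> linarith
  have e2 : |(-1 - x)| ≤ 3.07 := by rw [abs_le]; constructor <;> linarith
  have e3 : |(0 - x)| ≤ 2.07 := by rw [abs_le]; constructor <;> linarith
  have e4 : |(1 - x)| ≤ 1.07 := by rw [abs_le]; constructor <;> linarith
  have e5 : |(2 - x)| ≤ 0.07 := by rw [abs_le]; constructor <;> linarith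
  simp only [boundA, boundB, boundC, boundD, boundE, abs_mul, abs_pow]
  refine ⟨?_, ?_, ?_, ?_, ?_⟩ <;> gcongr

end RealBounds

/-! ### Newton's inequalities -/

section Newton

theorem newton_five_one (y1 y2 y3 y4 y5 : ℝ) :
    10 * ((y1 * y2 * y3 * y4 * y5) * (y1 * y2 * y3 + y1 * y2 * y4 + y1 * y2 * y5 + y1 * y3 * y4 +
      y1 * y3 * y5 + y1 * y4 * y5 + y2 * y3 * y4 + y2 * y3 * y5 + y2 * y4 * y5 + y3 * y4 * y5)) ≤
    4 * (y1 * y2 * y3 * y4 + y1 * y2 * y3 * y5 + y1 * y2 * y4 * y5 + y1 * y3 * y4 * y5 +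
      y2 * y3 * y4 * y5) ^ 2 := by
  have key (a b c d e : ℝ) : 10 * (a * b + a * c + a * d + a * e + b * c + b * d + b * e + c * d +
      c * e + d * e) ≤ 4 * (a + b + c + d + e) ^ 2 := by
    nlinarith [sq_nonneg (a - b), sq_nonneg (a - c), sq_nonneg (a - d), sq_nonneg (a - e),
      sq_nonneg (b - c), sq_nonneg (b - d), sq_nonneg (b - e), sq_nonneg (c - d),
      sq_nonneg (c - e), sq_nonneg (d - e)]
  have := key (y1 * y2 * y3 * y4) (y1 * y2 * y3 * y5) (y1 * y2 * y4 * y5) (y1 * y3 * y4 * y5)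
    (y2 * y3 * y4 * y5)
  linarith

/-- The difference of the two sides is a sum of squares: for each variable `m`, `m ^ 2` times the
squared differences of the three pairings of the other four variables. -/
theorem newton_five_two (y1 y2 y3 y4 y5 : ℝ) :
    2 * ((y1 * y2 * y3 * y4 + y1 * y2 * y3 * y5 + y1 * y2 * y4 * y5 + y1 * y3 * y4 * y5 +
      y2 * y3 * y4 * y5) * (y1 * y2 + y1 * y3 + y1 * y4 + y1 * y5 + y2 * y3 + y2 * y4 + y2 * y5 +
      y3 * y4 + y3 * y5 + y4 * y5)) ≤
    (y1 * y2 * y3 + y1 * y2 * y4 + y1 * y2 * y5 + y1 * y3 * y4 +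
      y1 * y3 * y5 + y1 * y4 * y5 + y2 * y3 * y4 + y2 * y3 * y5 + y2 * y4 * y5 +
      y3 * y4 * y5) ^ 2 := by
  have key (m a b c d : ℝ) : 0 ≤ m ^ 2 * ((a * b - c * d) ^ 2 + (a * c - b * d) ^ 2 +
    (a * d - b * c) ^ 2) := by positivity
  linarith [key y1 y2 y3 y4 y5, key y2 y1 y3 y4 y5, key y3 y1 y2 y4 y5, key y4 y1 y2 y3 y5,
    key y5 y1 y2 y3 y4]

theorem newton_four_one (y1 y2 y3 y4 : ℝ) :
    8 * ((y1 * y2 * y3 * y4) * (y1 * y2 + y1 * y3 + y1 * y4 + y2 * y3 + y2 * y4 + y3 * y4)) ≤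
    3 * (y1 * y2 * y3 + y1 * y2 * y4 + y1 * y3 * y4 + y2 * y3 * y4) ^ 2 := by
  have key (a b c d : ℝ) : 8 * (a * b + a * c + a * d + b * c + b * d + c * d) ≤
      3 * (a + b + c + d) ^ 2 := by
    nlinarith [sq_nonneg (a - b), sq_nonneg (a - c), sq_nonneg (a - d),
      sq_nonneg (b - c), sq_nonneg (b - d), sq_nonneg (c - d)]
  have := key (y1 * y2 * y3) (y1 * y2 * y4) (y1 * y3 * y4) (y2 * y3 * y4)
  linarith

end Newton

/-! ### Classification of the quintics -/

section Classification

theorem abs_mul_four_lt {A : ℝ → ℝ} {B B0 K β a b c : ℝ} (h0 : |A β| ≤ B0) (ha : |A a| ≤ B)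
    (hb : |A b| ≤ B) (hc : |A c| ≤ B) (hK : B0 * B * B * B < K) :
    |A β * A a * A b * A c| < K := by
  refine lt_of_le_of_lt ?_ hK
  rw [abs_mul, abs_mul, abs_mul]
  have : 0 ≤ B := (abs_nonneg _).trans ha
  have : 0 ≤ B0 := (abs_nonneg _).trans h0
  gcongr

theorem abs_mul_five_lt {A : ℝ → ℝ} {B B0 K β a b c d : ℝ} (h0 : |A β| ≤ B0) (ha : |A a| ≤ B)
    (hb : |A b| ≤ B) (hc : |A c| ≤ B) (hd : |A d| ≤ B) (hK : B0 * B * B * B * B < K) :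
    |A β * A a * A b * A c * A d| < K := by
  refine lt_of_le_of_lt ?_ hK
  rw [abs_mul, abs_mul, abs_mul, abs_mul]
  have : 0 ≤ B := (abs_nonneg _).trans ha
  have : 0 ≤ B0 := (abs_nonneg _).trans h0
  gcongr

/-- Newton's inequalities for the numbers `x - 2 r`, with `r` running over the roots; their
elementary symmetric functions are scaled derivatives of the quintic at `x / 2`. -/
theorem quinticNewton_of_roots {q4 q3 q2 q1 q0 : ℤ} {β a b c d : ℝ}
    (h4 : (q4 : ℝ) = -(β + a + b + c + d))
    (h3 : (q3 : ℝ) = β * a + β * b + β * c + β * d + a * b + a * c + a * d + b * c + b * d + c * d)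
    (h2 : (q2 : ℝ) = -(β * a * b + β * a * c + β * a * d + β * b * c + β * b * d + β * c * d +
      a * b * c + a * b * d + a * c * d + b * c * d))
    (h1 : (q1 : ℝ) = β * a * b * c + β * a * b * d + β * a * c * d + β * b * c * d + a * b * c * d)
    (h0 : (q0 : ℝ) = -(β * a * b * c * d)) (x : ℤ) : QuinticNewton q4 q3 q2 q1 q0 x := by
  have e0 : (x : ℝ) ^ 5 + 2 * q4 * x ^ 4 + 4 * q3 * x ^ 3 + 8 * q2 * x ^ 2 + 16 * q1 * x + 32 * q0 =
      (x - 2 * β) * (x - 2 * a) * (x - 2 * b) * (x - 2 * c) * (x - 2 * d) := by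
    rw [h4, h3, h2, h1, h0]; ring
  have n1 := newton_five_one ((x : ℝ) - 2 * β) (x - 2 * a) (x - 2 * b) (x - 2 * c) (x - 2 * d)
  have n2 := newton_five_two ((x : ℝ) - 2 * β) (x - 2 * a) (x - 2 * b) (x - 2 * c) (x - 2 * d)
  set y1 : ℝ := x - 2 * β with hy1
  set y2 : ℝ := x - 2 * a with hy2
  set y3 : ℝ := x - 2 * b with hy3
  set y4 : ℝ := x - 2 * c with hy4
  set y5 : ℝ := x - 2 * d with hy5
  have e1 : 5 * (x : ℝ) ^ 4 + 8 * q4 * x ^ 3 + 12 * q3 * x ^ 2 + 16 * q2 * x + 16 * q1 =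
      y1 * y2 * y3 * y4 + y1 * y2 * y3 * y5 + y1 * y2 * y4 * y5 + y1 * y3 * y4 * y5 +
      y2 * y3 * y4 * y5 := by
    rw [h4, h3, h2, h1, hy1, hy2, hy3, hy4, hy5]; ring
  have e2 : 10 * (x : ℝ) ^ 3 + 12 * q4 * x ^ 2 + 12 * q3 * x + 8 * q2 =
      y1 * y2 * y3 + y1 * y2 * y4 + y1 * y2 * y5 + y1 * y3 * y4 +
      y1 * y3 * y5 + y1 * y4 * y5 + y2 * y3 * y4 + y2 * y3 * y5 + y2 * y4 * y5 +
      y3 * y4 * y5 := by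
    rw [h4, h3, h2, hy1, hy2, hy3, hy4, hy5]; ring
  have e3 : 10 * (x : ℝ) ^ 2 + 8 * q4 * x + 4 * q3 =
      y1 * y2 + y1 * y3 + y1 * y4 + y1 * y5 + y2 * y3 + y2 * y4 + y2 * y5 +
      y3 * y4 + y3 * y5 + y4 * y5 := by
    rw [h4, h3, hy1, hy2, hy3, hy4, hy5]; ring
  rw [← e0, ← e1, ← e2] at n1
  rw [← e1, ← e2, ← e3] at n2
  exact ⟨by exact_mod_cast n1, by exact_mod_cast n2⟩

theorem quinticSearch_spec {q4 q3 q2 q1 q0 v2 v1 vm vn : ℤ}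
    (h2 : v2 = 32 + 16 * q4 + 8 * q3 + 4 * q2 + 2 * q1 + q0)
    (h1 : v1 = 1 + q4 + q3 + q2 + q1 + q0) (hm : vm = -1 + q4 - q3 + q2 - q1 + q0)
    (hn : vn = -32 + 16 * q4 - 8 * q3 + 4 * q2 - 2 * q1 + q0)
    (p2 : v2 < 0) (pn : vn < 0) (p1 : v1 ≠ 0) (pm : vm ≠ 0) (p0 : q0 ≠ 0)
    (hA : vn * vn * (vm * vm) * (v2 * v2 * (v2 * v2) * (v2 * v2)) ≤ 78400)
    (hA' : -vn * -v2 ≤ 280) (hB : -vn * (vm * vm) * (v1 * v1) * -v2 ≤ 787)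
    (hB' : vm * vm * (v1 * v1) * -v2 ≤ 787) (hC : -vn * (q0 * q0) * -v2 ≤ 312)
    (hC' : q0 * q0 * -v2 ≤ 312) (hD : vm * vm * -v2 ≤ 168)
    (r2 : -6 ≤ v2) (rm : -12 ≤ vm) (rm' : vm ≤ 12) (r1 : -28 ≤ v1) (r1' : v1 ≤ 28)
    (r0 : -17 ≤ q0) (r0' : q0 ≤ 17) (h4 : -10 ≤ q4) (h4' : q4 < 6)
    (hd : 0 < 80 - 32 * q4 + 12 * q3 - 4 * q2 + q1)
    (hr : 0 < 207 ^ 5 + 207 ^ 4 * 100 * q4 + 207 ^ 3 * 100 ^ 2 * q3 + 207 ^ 2 * 100 ^ 3 * q2 +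
      207 * 100 ^ 4 * q1 + 100 ^ 5 * q0)
    (hN : ∀ x, QuinticNewton q4 q3 q2 q1 q0 x) : (q4, q3, q2, q1, q0) ∈ quinticList := by
  have g := quinticSearch_eq_true
  unfold quinticSearch at g
  have g := of_intAll g (x := v2) (by omega) (by omega)
  have g := of_intAll g (x := vm) (by omega) (by omega)
  rw [Bool.or_eq_true, decide_eq_true_eq] at g
  have g := of_intAll (g.resolve_left (not_or.2 ⟨pm, not_lt.2 hD⟩)) (x := v1) (by omega) (by omega)
  rw [Bool.or_eq_true, decide_eq_true_eq] at g
  have g := of_intAll (g.resolve_left (not_or.2 ⟨p1, not_or.2 ⟨by omega, not_lt.2 hB'⟩⟩)) (x := q0) (by omega) (by omega)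
  rw [Bool.or_eq_true, decide_eq_true_eq] at g
  have g := of_intAll (g.resolve_left (not_or.2 ⟨p0, not_or.2 ⟨by omega, not_lt.2 hC'⟩⟩)) (x := q4) (by omega) (by omega)
  rw [show 24 * q4 - v2 + 4 * v1 + 4 * vm - 6 * q0 = vn by omega,
    show (v2 - 30 - 3 * v1 - vm + 3 * q0) / 6 - 2 * q4 = q3 by omega,
    show (v1 + vm) / 2 - q4 - q0 = q2 by omega,
    show (v1 - vm) / 2 - 1 - (v2 - 30 - 3 * v1 - vm + 3 * q0) / 6 + 2 * q4 = q1 by omega,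
    Bool.or_eq_true, quinticValues, decide_eq_true_eq] at g
  have g := g.resolve_left (by
    rintro (h | h | h | h | h)
    · omega
    · exact absurd hA' (not_le.2 h)
    · exact absurd hB (not_le.2 h)
    · exact absurd hC (not_le.2 h)
    · exact absurd hA (not_le.2 h))
  rw [quinticLeaf, decide_eq_true_eq] at g
  simpa only [hd, hr, hN, not_true_eq_false, false_or] using g

/-- Nonzero integers have absolute value at least 1, so factors may be dropped from the product
bounds. This confines each single value to the range searched, for instance `-6 ≤ v2` since `7 ^ 6 >
280 ^ 2`. -/
theorem mem_quinticList {q4 q3 q2 q1 q0 v2 v1 vm vn : ℤ}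
    (h2 : v2 = 32 + 16 * q4 + 8 * q3 + 4 * q2 + 2 * q1 + q0)
    (h1 : v1 = 1 + q4 + q3 + q2 + q1 + q0) (hm : vm = -1 + q4 - q3 + q2 - q1 + q0)
    (hn : vn = -32 + 16 * q4 - 8 * q3 + 4 * q2 - 2 * q1 + q0)
    (p2 : v2 < 0) (pn : vn < 0) (p1 : v1 ≠ 0) (pm : vm ≠ 0) (p0 : q0 ≠ 0)
    (hA : |vn * vm * v2 ^ 3| ≤ 280) (hB : |vn * vm ^ 2 * v1 ^ 2 * v2| ≤ 787)
    (hC : |vn * q0 ^ 2 * v2| ≤ 312) (hD : |vm ^ 2 * v2| ≤ 168) (h4 : -10 ≤ q4) (h4' : q4 < 6)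
    (hd : 0 < 80 - 32 * q4 + 12 * q3 - 4 * q2 + q1)
    (hr : 0 < 207 ^ 5 + 207 ^ 4 * 100 * q4 + 207 ^ 3 * 100 ^ 2 * q3 + 207 ^ 2 * 100 ^ 3 * q2 +
      207 * 100 ^ 4 * q1 + 100 ^ 5 * q0)
    (hN : ∀ x, QuinticNewton q4 q3 q2 q1 q0 x) : (q4, q3, q2, q1, q0) ∈ quinticList := by
  have s1 : 1 ≤ v1 * v1 := by have := mul_self_pos.2 p1; omega
  have sm : 1 ≤ vm * vm := by have := mul_self_pos.2 pm; omega
  have s0 : 1 ≤ q0 * q0 := by have := mul_self_pos.2 p0; omega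
  have s2 : 1 ≤ -v2 := by omega
  have sn : 1 ≤ -vn := by omega
  have hB' : -vn * (vm * vm) * (v1 * v1) * -v2 ≤ 787 := by
    have := (abs_le.1 hB).2; linarith only [this]
  have hC' : -vn * (q0 * q0) * -v2 ≤ 312 := by
    have := (abs_le.1 hC).2; linarith only [this]
  have hD' : vm * vm * -v2 ≤ 168 := by
    have := (abs_le.1 hD).1; linarith only [this]
  -- The bound is squared because the sign of `vm` is unknown.
  have hA' : vn * vn * (vm * vm) * (v2 * v2 * (v2 * v2) * (v2 * v2)) ≤ 78400 := by
    have := sq_le_sq' (abs_le.1 hA).1 (abs_le.1 hA).2; linarith only [this]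
  have hB1 : vm * vm * (v1 * v1) * -v2 ≤ 787 := by
    have : 1 * (vm * vm * (v1 * v1) * -v2) ≤ -vn * (vm * vm * (v1 * v1) * -v2) :=
      mul_le_mul_of_nonneg_right sn (by positivity)
    linarith only [this, hB']
  have hB2 : v1 * v1 ≤ 787 := by
    have : 1 * (v1 * v1) ≤ (vm * vm * -v2) * (v1 * v1) :=
      mul_le_mul_of_nonneg_right (one_le_mul_of_one_le_of_one_le sm s2) (by positivity)
    linarith only [this, hB1]
  have hC1 : q0 * q0 * -v2 ≤ 312 := by
    have : 1 * (q0 * q0 * -v2) ≤ -vn * (q0 * q0 * -v2) :=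
      mul_le_mul_of_nonneg_right sn (by positivity)
    linarith only [this, hC']
  have hC2 : q0 * q0 ≤ 312 := by nlinarith only [hC1, s2, s0]
  have hD1 : vm * vm ≤ 168 := by nlinarith only [hD', s2, sm]
  have t2 : 1 ≤ v2 * v2 := by nlinarith only [s2]
  have hA1 : v2 * v2 * (v2 * v2) * (v2 * v2) ≤ 78400 := by
    have : 1 * (v2 * v2 * (v2 * v2) * (v2 * v2)) ≤
        vn * vn * (vm * vm) * (v2 * v2 * (v2 * v2) * (v2 * v2)) :=
      mul_le_mul_of_nonneg_right (one_le_mul_of_one_le_of_one_le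
        (by nlinarith only [sn]) sm) (by positivity)
    linarith only [this, hA']
  have hA2 : -vn * -v2 ≤ 280 := by
    by_contra hc
    have hc' : 281 ≤ vn * v2 := by linarith only [not_le.1 hc]
    have e1 : 281 * 281 ≤ vn * v2 * (vn * v2) :=
      mul_le_mul hc' hc' (by norm_num) (by linarith only [hc'])
    have e2 : 1 * (vn * v2 * (vn * v2)) ≤
        (vm * vm * (v2 * v2 * (v2 * v2))) * (vn * v2 * (vn * v2)) :=
      mul_le_mul_of_nonneg_right (one_le_mul_of_one_le_of_one_le sm
        (one_le_mul_of_one_le_of_one_le t2 t2)) (mul_self_nonneg _)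
    linarith only [e1, e2, hA']
  have r2 : -6 ≤ v2 := by
    by_contra hc
    have : 49 ≤ v2 * v2 := by nlinarith only [not_le.1 hc]
    have h3 : 49 * 49 ≤ v2 * v2 * (v2 * v2) := mul_le_mul this this (by norm_num) (by linarith only [this])
    have : 49 * 49 * 49 ≤ v2 * v2 * (v2 * v2) * (v2 * v2) :=
      mul_le_mul h3 this (by norm_num) (by linarith only [h3])
    linarith only [this, hA1]
  have rm := abs_lt_of_sq_lt_sq' (a := vm) (b := 13) (by nlinarith only [hD1]) (by norm_num)
  have r1 := abs_lt_of_sq_lt_sq' (a := v1) (b := 29) (by nlinarith only [hB2]) (by norm_num)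
  have r0 := abs_lt_of_sq_lt_sq' (a := q0) (b := 18) (by nlinarith only [hC2]) (by norm_num)
  exact quinticSearch_spec h2 h1 hm hn p2 pn p1 pm p0 hA' hA2 hB' hB1 hC' hC1 hD' r2
    (by omega) (by omega) (by omega) (by omega) (by omega) (by omega) h4 h4' hd hr hN

theorem quintic_classification {q4 q3 q2 q1 q0 : ℤ} {β a b c d : ℝ}
    (h : ∀ x : ℝ, x ^ 5 + q4 * x ^ 4 + q3 * x ^ 3 + q2 * x ^ 2 + q1 * x + q0 =
      (x - β) * (x - a) * (x - b) * (x - c) * (x - d))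
    (hβ : 2 < β) (hβ' : β < 2.07) (ha : -2 < a ∧ a < 2) (hb : -2 < b ∧ b < 2)
    (hc : -2 < c ∧ c < 2) (hd : -2 < d ∧ d < 2)
    (hne : ∀ m : ℤ, m ^ 5 + q4 * m ^ 4 + q3 * m ^ 3 + q2 * m ^ 2 + q1 * m + q0 ≠ 0) :
    (q4, q3, q2, q1, q0) ∈ quinticList := by
  have H0 := h 0
  have H1 := h 1
  have Hm := h (-1)
  have H2 := h 2
  have Hn := h (-2)
  -- Vieta's formulas, obtained by finite differences from the values at `0, ±1, ±2`.
  have h4 : (q4 : ℝ) = -(β + a + b + c + d) := by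
    linear_combination (H2 + Hn - 4 * H1 - 4 * Hm + 6 * H0) / 24
  have h3 : (q3 : ℝ) = β * a + β * b + β * c + β * d + a * b + a * c + a * d + b * c + b * d +
      c * d := by
    linear_combination ((H2 - Hn) / 2 - (H1 - Hm)) / 6
  have h2 : (q2 : ℝ) = -(β * a * b + β * a * c + β * a * d + β * b * c + β * b * d + β * c * d +
      a * b * c + a * b * d + a * c * d + b * c * d) := by
    linear_combination (-H2 - Hn + 16 * H1 + 16 * Hm - 30 * H0) / 24
  have h1 : (q1 : ℝ) = β * a * b * c + β * a * b * d + β * a * c * d + β * b * c * d +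
      a * b * c * d := by
    linear_combination (4 * (H1 - Hm) - (H2 - Hn) / 2) / 6
  have h0 : (q0 : ℝ) = -(β * a * b * c * d) := by linear_combination H0
  obtain ⟨BA, BB, BC, BD, -⟩ := abs_bounds_of_gt hβ hβ'
  have v2 : ((32 + 16 * q4 + 8 * q3 + 4 * q2 + 2 * q1 + q0 : ℤ) : ℝ) =
    (2 - β) * (2 - a) * (2 - b) * (2 - c) * (2 - d) := by push_cast; linear_combination H2
  have v1 : ((1 + q4 + q3 + q2 + q1 + q0 : ℤ) : ℝ) =
    (1 - β) * (1 - a) * (1 - b) * (1 - c) * (1 - d) := by push_cast; linear_combination H1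
  have vm : ((-1 + q4 - q3 + q2 - q1 + q0 : ℤ) : ℝ) =
    (-1 - β) * (-1 - a) * (-1 - b) * (-1 - c) * (-1 - d) := by push_cast; linear_combination Hm
  have vn : ((-32 + 16 * q4 - 8 * q3 + 4 * q2 - 2 * q1 + q0 : ℤ) : ℝ) =
    (-2 - β) * (-2 - a) * (-2 - b) * (-2 - c) * (-2 - d) := by push_cast; linear_combination Hn
  have v0 : (q0 : ℝ) = (0 - β) * (0 - a) * (0 - b) * (0 - c) * (0 - d) := by
    linear_combination H0
  have x1 : 0 < (2 - a) * (2 - b) * (2 - c) * (2 - d) :=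
    mul_pos (mul_pos (mul_pos (by linarith) (by linarith)) (by linarith)) (by linarith)
  have x2 : 0 < (a + 2) * (b + 2) * (c + 2) * (d + 2) :=
    mul_pos (mul_pos (mul_pos (by linarith) (by linarith)) (by linarith)) (by linarith)
  refine mem_quinticList rfl rfl rfl rfl ?_ ?_ ?_ ?_ ?_ ?_ ?_ ?_ ?_ ?_ ?_ ?_ ?_
    (quinticNewton_of_roots h4 h3 h2 h1 h0)
  · rify
    push_cast at v2
    rw [v2, show (2 - β) * (2 - a) * (2 - b) * (2 - c) * (2 - d) =
      -((β - 2) * ((2 - a) * (2 - b) * (2 - c) * (2 - d))) by ring]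
    exact neg_neg_of_pos (mul_pos (sub_pos.2 hβ) x1)
  · rify
    push_cast at vn
    rw [vn, show (-2 - β) * (-2 - a) * (-2 - b) * (-2 - c) * (-2 - d) =
      -((β + 2) * ((a + 2) * (b + 2) * (c + 2) * (d + 2))) by ring]
    exact neg_neg_of_pos (mul_pos (by linarith) x2)
  · have := hne 1; intro h5; apply this; linear_combination h5
  · have := hne (-1); intro h5; apply this; linear_combination h5
  · have := hne 0; intro h5; apply this; linear_combination h5
  -- The left side is the absolute value of the product of `boundA` over the five roots. It is at
  -- most `4.07 * 3.07 * 0.07 ^ 3 * 16 ^ 4 < 281`, hence at most `280` as an integer. The next three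
  -- bounds arise in the same way from `boundB`, `boundC` and `boundD`.
  · rw [← Int.lt_add_one_iff]
    have := abs_mul_five_lt (K := 281) BA (abs_boundA_le ha.1 ha.2) (abs_boundA_le hb.1 hb.2)
      (abs_boundA_le hc.1 hc.2) (abs_boundA_le hd.1 hd.2) (by norm_num)
    rw [← Int.cast_lt (R := ℝ), Int.cast_abs]
    refine lt_of_eq_of_lt (congrArg _ ?_) (this.trans_eq (by norm_num))
    push_cast at v2 vm vn ⊢
    rw [v2, vm, vn]
    simp only [boundA, mul_pow]
    ac_rfl
  · rw [← Int.lt_add_one_iff]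
    have := abs_mul_five_lt (K := 788) BB (abs_boundB_le ha.1 ha.2) (abs_boundB_le hb.1 hb.2)
      (abs_boundB_le hc.1 hc.2) (abs_boundB_le hd.1 hd.2) (by norm_num)
    rw [← Int.cast_lt (R := ℝ), Int.cast_abs]
    refine lt_of_eq_of_lt (congrArg _ ?_) (this.trans_eq (by norm_num))
    push_cast at v2 v1 vm vn ⊢
    rw [v2, v1, vm, vn]
    simp only [boundB, mul_pow]
    ac_rfl
  · rw [← Int.lt_add_one_iff]
    have := abs_mul_five_lt (K := 313) BC (abs_boundC_le ha.1 ha.2) (abs_boundC_le hb.1 hb.2)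
      (abs_boundC_le hc.1 hc.2) (abs_boundC_le hd.1 hd.2) (by norm_num)
    rw [← Int.cast_lt (R := ℝ), Int.cast_abs]
    refine lt_of_eq_of_lt (congrArg _ ?_) (this.trans_eq (by norm_num))
    push_cast at v2 v0 vn ⊢
    rw [v2, vn, v0]
    simp only [boundC, mul_pow]
    ac_rfl
  · rw [← Int.lt_add_one_iff]
    have := abs_mul_five_lt (K := 169) BD (abs_boundD_le ha.1 ha.2) (abs_boundD_le hb.1 hb.2)
      (abs_boundD_le hc.1 hc.2) (abs_boundD_le hd.1 hd.2) (by norm_num)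
    rw [← Int.cast_lt (R := ℝ), Int.cast_abs]
    refine lt_of_eq_of_lt (congrArg _ ?_) (this.trans_eq (by norm_num))
    push_cast at v2 vm ⊢
    rw [v2, vm]
    simp only [boundD, mul_pow]
    ac_rfl
  · have : ((-11 : ℤ) : ℝ) < q4 := by push_cast; linarith
    have := Int.cast_lt.1 this
    omega
  · have : (q4 : ℝ) < (6 : ℤ) := by push_cast; linarith
    exact Int.cast_lt.1 this
  -- The expression is the derivative of the quintic at `-2`, which is positive because all roots
  -- exceed `-2`.
  · have y0 : 0 < β + 2 := by linarith
    have ya : 0 < a + 2 := by linarith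
    have yb : 0 < b + 2 := by linarith
    have yc : 0 < c + 2 := by linarith
    have yd : 0 < d + 2 := by linarith
    have : ((80 - 32 * q4 + 12 * q3 - 4 * q2 + q1 : ℤ) : ℝ) =
        (a + 2) * (b + 2) * (c + 2) * (d + 2) + (β + 2) * (b + 2) * (c + 2) * (d + 2) +
        (β + 2) * (a + 2) * (c + 2) * (d + 2) + (β + 2) * (a + 2) * (b + 2) * (d + 2) +
        (β + 2) * (a + 2) * (b + 2) * (c + 2) := by
      push_cast; rw [h4, h3, h2, h1]; ring
    rw [← Int.cast_pos (R := ℝ), this]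
    positivity
  -- The expression is `100 ^ 5` times the value at `2.07`, which lies to the right of all roots.
  · have : ((207 ^ 5 + 207 ^ 4 * 100 * q4 + 207 ^ 3 * 100 ^ 2 * q3 + 207 ^ 2 * 100 ^ 3 * q2 +
        207 * 100 ^ 4 * q1 + 100 ^ 5 * q0 : ℤ) : ℝ) =
        100 ^ 5 * ((2.07 - β) * (2.07 - a) * (2.07 - b) * (2.07 - c) * (2.07 - d)) := by
      rw [← h 2.07]; push_cast; ring
    rw [← Int.cast_pos (R := ℝ), this]
    exact mul_pos (by norm_num) (mul_pos (mul_pos (mul_pos (mul_pos (by linarith) (by linarith))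
      (by linarith)) (by linarith)) (by linarith))

end Classification

/-! ### Classification in degrees 2, 3 and 4 -/

section SmallDegree

theorem quarticNewton_of_roots {q3 q2 q1 q0 : ℤ} {β a b c : ℝ}
    (h3 : (q3 : ℝ) = -(β + a + b + c))
    (h2 : (q2 : ℝ) = β * a + β * b + β * c + a * b + a * c + b * c)
    (h1 : (q1 : ℝ) = -(β * a * b + β * a * c + β * b * c + a * b * c))
    (h0 : (q0 : ℝ) = β * a * b * c) (x : ℤ) : QuarticNewton q3 q2 q1 q0 x := by
  have e0 : (x : ℝ) ^ 4 + q3 * x ^ 3 + q2 * x ^ 2 + q1 * x + q0 =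
      (x - β) * (x - a) * (x - b) * (x - c) := by
    rw [h3, h2, h1, h0]; ring
  have n1 := newton_four_one ((x : ℝ) - β) (x - a) (x - b) (x - c)
  set y1 : ℝ := x - β with hy1
  set y2 : ℝ := x - a with hy2
  set y3 : ℝ := x - b with hy3
  set y4 : ℝ := x - c with hy4
  have e1 : 4 * (x : ℝ) ^ 3 + 3 * q3 * x ^ 2 + 2 * q2 * x + q1 =
      y1 * y2 * y3 + y1 * y2 * y4 + y1 * y3 * y4 + y2 * y3 * y4 := by
    rw [h3, h2, h1, hy1, hy2, hy3, hy4]; ring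
  have e2 : 6 * (x : ℝ) ^ 2 + 3 * q3 * x + q2 =
      y1 * y2 + y1 * y3 + y1 * y4 + y2 * y3 + y2 * y4 + y3 * y4 := by
    rw [h3, h2, hy1, hy2, hy3, hy4]; ring
  rw [← e0, ← e1, ← e2] at n1
  unfold QuarticNewton
  exact_mod_cast n1

theorem quarticSearch_spec {q3 q2 q1 q0 v2 v1 vm vn : ℤ}
    (h2 : v2 = 16 + 8 * q3 + 4 * q2 + 2 * q1 + q0)
    (h1 : v1 = 1 + q3 + q2 + q1 + q0) (hm : vm = 1 - q3 + q2 - q1 + q0)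
    (hn : vn = 16 - 8 * q3 + 4 * q2 - 2 * q1 + q0)
    (p2 : v2 < 0) (pn : 0 < vn) (p1 : v1 ≠ 0) (pm : vm ≠ 0) (p0 : q0 ≠ 0)
    (hA : vn * vn * (vm * vm) * (v2 * v2 * (v2 * v2) * (v2 * v2)) ≤ 289)
    (hB : vn * (vm * vm) * (v1 * v1) * -v2 ≤ 196)
    (hB' : vm * vm * (v1 * v1) * -v2 ≤ 196) (hC : vn * (q0 * q0) * -v2 ≤ 78)
    (hC' : q0 * q0 * -v2 ≤ 78) (hD : vm * vm * -v2 ≤ 42)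
    (r2 : -2 ≤ v2) (rm : -6 ≤ vm) (rm' : vm ≤ 6) (r1 : -14 ≤ v1) (r1' : v1 ≤ 14)
    (r0 : -8 ≤ q0) (r0' : q0 ≤ 8)
    (hr : 0 < 207 ^ 4 + 207 ^ 3 * 100 * q3 + 207 ^ 2 * 100 ^ 2 * q2 + 207 * 100 ^ 3 * q1 +
      100 ^ 4 * q0)
    (hN : ∀ x, QuarticNewton q3 q2 q1 q0 x) : (q3, q2, q1, q0) = (0, -4, -1, 1) := by
  have g := quarticSearch_eq_true
  unfold quarticSearch at g
  have g := of_intAll g (x := v2) (by omega) (by omega)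
  have g := of_intAll g (x := vm) (by omega) (by omega)
  rw [Bool.or_eq_true, decide_eq_true_eq] at g
  have g := of_intAll (g.resolve_left (not_or.2 ⟨pm, not_lt.2 hD⟩)) (x := v1) (by omega) (by omega)
  rw [Bool.or_eq_true, decide_eq_true_eq] at g
  have g := of_intAll (g.resolve_left (not_or.2 ⟨p1, not_or.2 ⟨by omega, not_lt.2 hB'⟩⟩))
    (x := q0) (by omega) (by omega)
  rw [Bool.or_eq_true, Bool.or_eq_true, decide_eq_true_eq,
    show 24 - v2 + 4 * v1 + 4 * vm - 6 * q0 = vn by omega,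
    show (v2 - 12 - 3 * v1 - vm + 3 * q0) / 6 = q3 by omega,
    show (v1 + vm) / 2 - 1 - q0 = q2 by omega,
    show (v1 - vm) / 2 - q3 = q1 by omega, quarticValues, decide_eq_true_eq] at g
  have g := g.resolve_left (by
    rintro ((h | h | h) | h | h | h | h)
    · exact p0 h
    · omega
    · exact absurd hC' (not_le.2 h)
    · omega
    · exact absurd hB (not_le.2 h)
    · exact absurd hC (not_le.2 h)
    · exact absurd hA (not_le.2 h))
  rw [quarticLeaf, decide_eq_true_eq] at g
  simpa only [hr, hN, not_true_eq_false, false_or] using g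

theorem eq_of_quartic_bounds {q3 q2 q1 q0 v2 v1 vm vn : ℤ}
    (h2 : v2 = 16 + 8 * q3 + 4 * q2 + 2 * q1 + q0)
    (h1 : v1 = 1 + q3 + q2 + q1 + q0) (hm : vm = 1 - q3 + q2 - q1 + q0)
    (hn : vn = 16 - 8 * q3 + 4 * q2 - 2 * q1 + q0)
    (p2 : v2 < 0) (pn : 0 < vn) (p1 : v1 ≠ 0) (pm : vm ≠ 0) (p0 : q0 ≠ 0)
    (hA : |vn * vm * v2 ^ 3| ≤ 17) (hB : |vn * vm ^ 2 * v1 ^ 2 * v2| ≤ 196)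
    (hC : |vn * q0 ^ 2 * v2| ≤ 78) (hD : |vm ^ 2 * v2| ≤ 42)
    (hr : 0 < 207 ^ 4 + 207 ^ 3 * 100 * q3 + 207 ^ 2 * 100 ^ 2 * q2 + 207 * 100 ^ 3 * q1 +
      100 ^ 4 * q0)
    (hN : ∀ x, QuarticNewton q3 q2 q1 q0 x) : (q3, q2, q1, q0) = (0, -4, -1, 1) := by
  have s1 : 1 ≤ v1 * v1 := by have := mul_self_pos.2 p1; omega
  have sm : 1 ≤ vm * vm := by have := mul_self_pos.2 pm; omega
  have s0 : 1 ≤ q0 * q0 := by have := mul_self_pos.2 p0; omega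
  have s2 : 1 ≤ -v2 := by omega
  have sn : 1 ≤ vn := by omega
  have hB' : vn * (vm * vm) * (v1 * v1) * -v2 ≤ 196 := by
    have := (abs_le.1 hB).1; linarith only [this]
  have hC' : vn * (q0 * q0) * -v2 ≤ 78 := by
    have := (abs_le.1 hC).1; linarith only [this]
  have hD' : vm * vm * -v2 ≤ 42 := by
    have := (abs_le.1 hD).1; linarith only [this]
  have hA' : vn * vn * (vm * vm) * (v2 * v2 * (v2 * v2) * (v2 * v2)) ≤ 289 := by
    have := sq_le_sq' (abs_le.1 hA).1 (abs_le.1 hA).2; linarith only [this]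
  have hB1 : vm * vm * (v1 * v1) * -v2 ≤ 196 := by
    have : 1 * (vm * vm * (v1 * v1) * -v2) ≤ vn * (vm * vm * (v1 * v1) * -v2) :=
      mul_le_mul_of_nonneg_right sn (by positivity)
    linarith only [this, hB']
  have hB2 : v1 * v1 ≤ 196 := by
    have : 1 * (v1 * v1) ≤ (vm * vm * -v2) * (v1 * v1) :=
      mul_le_mul_of_nonneg_right (one_le_mul_of_one_le_of_one_le sm s2) (by positivity)
    linarith only [this, hB1]
  have hC1 : q0 * q0 * -v2 ≤ 78 := by
    have : 1 * (q0 * q0 * -v2) ≤ vn * (q0 * q0 * -v2) :=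
      mul_le_mul_of_nonneg_right sn (by positivity)
    linarith only [this, hC']
  have hC2 : q0 * q0 ≤ 78 := by nlinarith only [hC1, s2, s0]
  have hD1 : vm * vm ≤ 42 := by nlinarith only [hD', s2, sm]
  have hA1 : v2 * v2 * (v2 * v2) * (v2 * v2) ≤ 289 := by
    have : 1 * (v2 * v2 * (v2 * v2) * (v2 * v2)) ≤
        vn * vn * (vm * vm) * (v2 * v2 * (v2 * v2) * (v2 * v2)) :=
      mul_le_mul_of_nonneg_right (one_le_mul_of_one_le_of_one_le
        (by nlinarith only [sn]) sm) (mul_nonneg (mul_nonneg (mul_self_nonneg _)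
        (mul_self_nonneg _)) (mul_self_nonneg _))
    linarith only [this, hA']
  have r2 : -2 ≤ v2 := by
    by_contra hc
    have : 9 ≤ v2 * v2 := by nlinarith only [not_le.1 hc]
    have h3 : 9 * 9 ≤ v2 * v2 * (v2 * v2) := mul_le_mul this this (by norm_num)
      (by linarith only [this])
    have : 9 * 9 * 9 ≤ v2 * v2 * (v2 * v2) * (v2 * v2) :=
      mul_le_mul h3 this (by norm_num) (by linarith only [h3])
    linarith only [this, hA1]
  have rm := abs_lt_of_sq_lt_sq' (a := vm) (b := 7) (by nlinarith only [hD1]) (by norm_num)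
  have r1 := abs_lt_of_sq_lt_sq' (a := v1) (b := 15) (by nlinarith only [hB2]) (by norm_num)
  have r0 := abs_lt_of_sq_lt_sq' (a := q0) (b := 9) (by nlinarith only [hC2]) (by norm_num)
  exact quarticSearch_spec h2 h1 hm hn p2 pn p1 pm p0 hA' hB' hB1 hC' hC1 hD' r2
    (by omega) (by omega) (by omega) (by omega) (by omega) (by omega) hr hN

theorem quartic_classification {q3 q2 q1 q0 : ℤ} {β a b c : ℝ}
    (h : ∀ x : ℝ, x ^ 4 + q3 * x ^ 3 + q2 * x ^ 2 + q1 * x + q0 =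
      (x - β) * (x - a) * (x - b) * (x - c))
    (hβ : 2 < β) (hβ' : β < 2.07) (ha : -2 < a ∧ a < 2) (hb : -2 < b ∧ b < 2)
    (hc : -2 < c ∧ c < 2)
    (hne : ∀ m : ℤ, m ^ 4 + q3 * m ^ 3 + q2 * m ^ 2 + q1 * m + q0 ≠ 0) :
    (q3, q2, q1, q0) = (0, -4, -1, 1) := by
  have H0 := h 0
  have H1 := h 1
  have Hm := h (-1)
  have H2 := h 2
  have Hn := h (-2)
  have h3 : (q3 : ℝ) = -(β + a + b + c) := by
    linear_combination ((H2 - Hn) / 2 - (H1 - Hm)) / 6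
  have h2 : (q2 : ℝ) = β * a + β * b + β * c + a * b + a * c + b * c := by
    linear_combination (H1 + Hm) / 2 - H0
  have h1 : (q1 : ℝ) = -(β * a * b + β * a * c + β * b * c + a * b * c) := by
    linear_combination (4 * (H1 - Hm) - (H2 - Hn) / 2) / 6
  have h0 : (q0 : ℝ) = β * a * b * c := by linear_combination H0
  obtain ⟨BA, BB, BC, BD, -⟩ := abs_bounds_of_gt hβ hβ'
  have v2 : ((16 + 8 * q3 + 4 * q2 + 2 * q1 + q0 : ℤ) : ℝ) =
    (2 - β) * (2 - a) * (2 - b) * (2 - c) := by push_cast; linear_combination H2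
  have v1 : ((1 + q3 + q2 + q1 + q0 : ℤ) : ℝ) =
    (1 - β) * (1 - a) * (1 - b) * (1 - c) := by push_cast; linear_combination H1
  have vm : ((1 - q3 + q2 - q1 + q0 : ℤ) : ℝ) =
    (-1 - β) * (-1 - a) * (-1 - b) * (-1 - c) := by push_cast; linear_combination Hm
  have vn : ((16 - 8 * q3 + 4 * q2 - 2 * q1 + q0 : ℤ) : ℝ) =
    (-2 - β) * (-2 - a) * (-2 - b) * (-2 - c) := by push_cast; linear_combination Hn
  have v0 : (q0 : ℝ) = (0 - β) * (0 - a) * (0 - b) * (0 - c) := by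
    linear_combination H0
  have x1 : 0 < (2 - a) * (2 - b) * (2 - c) :=
    mul_pos (mul_pos (by linarith) (by linarith)) (by linarith)
  have x2 : 0 < (a + 2) * (b + 2) * (c + 2) :=
    mul_pos (mul_pos (by linarith) (by linarith)) (by linarith)
  refine eq_of_quartic_bounds rfl rfl rfl rfl ?_ ?_ ?_ ?_ ?_ ?_ ?_ ?_ ?_ ?_
    (quarticNewton_of_roots h3 h2 h1 h0)
  · rify
    push_cast at v2
    rw [v2, show (2 - β) * (2 - a) * (2 - b) * (2 - c) =
      -((β - 2) * ((2 - a) * (2 - b) * (2 - c))) by ring]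
    exact neg_neg_of_pos (mul_pos (sub_pos.2 hβ) x1)
  · rify
    push_cast at vn
    rw [vn, show (-2 - β) * (-2 - a) * (-2 - b) * (-2 - c) =
      (β + 2) * ((a + 2) * (b + 2) * (c + 2)) by ring]
    exact mul_pos (by linarith) x2
  · have := hne 1; intro h5; apply this; linear_combination h5
  · have := hne (-1); intro h5; apply this; linear_combination h5
  · have := hne 0; intro h5; apply this; linear_combination h5
  · rw [← Int.lt_add_one_iff]
    have := abs_mul_four_lt (K := 18) BA (abs_boundA_le ha.1 ha.2) (abs_boundA_le hb.1 hb.2)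
      (abs_boundA_le hc.1 hc.2) (by norm_num)
    rw [← Int.cast_lt (R := ℝ), Int.cast_abs]
    refine lt_of_eq_of_lt (congrArg _ ?_) (this.trans_eq (by norm_num))
    push_cast at v2 vm vn ⊢
    rw [v2, vm, vn]
    simp only [boundA, mul_pow]
    ac_rfl
  · rw [← Int.lt_add_one_iff]
    have := abs_mul_four_lt (K := 197) BB (abs_boundB_le ha.1 ha.2) (abs_boundB_le hb.1 hb.2)
      (abs_boundB_le hc.1 hc.2) (by norm_num)
    rw [← Int.cast_lt (R := ℝ), Int.cast_abs]
    refine lt_of_eq_of_lt (congrArg _ ?_) (this.trans_eq (by norm_num))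
    push_cast at v2 v1 vm vn ⊢
    rw [v2, v1, vm, vn]
    simp only [boundB, mul_pow]
    ac_rfl
  · rw [← Int.lt_add_one_iff]
    have := abs_mul_four_lt (K := 79) BC (abs_boundC_le ha.1 ha.2) (abs_boundC_le hb.1 hb.2)
      (abs_boundC_le hc.1 hc.2) (by norm_num)
    rw [← Int.cast_lt (R := ℝ), Int.cast_abs]
    refine lt_of_eq_of_lt (congrArg _ ?_) (this.trans_eq (by norm_num))
    push_cast at v2 v0 vn ⊢
    rw [v2, vn, v0]
    simp only [boundC, mul_pow]
    ac_rfl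
  · rw [← Int.lt_add_one_iff]
    have := abs_mul_four_lt (K := 43) BD (abs_boundD_le ha.1 ha.2) (abs_boundD_le hb.1 hb.2)
      (abs_boundD_le hc.1 hc.2) (by norm_num)
    rw [← Int.cast_lt (R := ℝ), Int.cast_abs]
    refine lt_of_eq_of_lt (congrArg _ ?_) (this.trans_eq (by norm_num))
    push_cast at v2 vm ⊢
    rw [v2, vm]
    simp only [boundD, mul_pow]
    ac_rfl
  · have : ((207 ^ 4 + 207 ^ 3 * 100 * q3 + 207 ^ 2 * 100 ^ 2 * q2 +
        207 * 100 ^ 3 * q1 + 100 ^ 4 * q0 : ℤ) : ℝ) =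
        100 ^ 4 * ((2.07 - β) * (2.07 - a) * (2.07 - b) * (2.07 - c)) := by
      rw [← h 2.07]; push_cast; ring
    rw [← Int.cast_pos (R := ℝ), this]
    exact mul_pos (by norm_num) (mul_pos (mul_pos (mul_pos (by linarith) (by linarith))
      (by linarith)) (by linarith))

/-- There is no cubic with one root in `(2, 2.07)` and the others in `(-2, 2)`, apart from those
that vanish at `2` or `-2`. -/
theorem cubic_value_eq_zero {v2 vn : ℤ} {β a b : ℝ}
    (h2 : (v2 : ℝ) = (2 - β) * (2 - a) * (2 - b)) (hn : (vn : ℝ) = (-2 - β) * (-2 - a) * (-2 - b))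
    (hβ : 2 < β) (hβ' : β < 2.07) (ha : -2 < a ∧ a < 2) (hb : -2 < b ∧ b < 2) :
    v2 = 0 ∨ vn = 0 := by
  obtain ⟨-, -, -, -, BE⟩ := abs_bounds_of_gt hβ hβ'
  -- This product equals the integer `vn * v2 ^ 4`, which therefore vanishes.
  have h : |boundE β * boundE a * boundE b| < 1 := by
    rw [abs_mul, abs_mul]
    have h1 := abs_boundE_le ha.1 ha.2
    have h2 := abs_boundE_le hb.1 hb.2
    calc |boundE β| * |boundE a| * |boundE b| ≤ 4.07 * 0.07 ^ 4 * 90 * 90 := by gcongr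
      _ < 1 := by norm_num
  have h3 : |vn * v2 ^ 4| < 1 := by
    rw [← Int.cast_lt (R := ℝ), Int.cast_abs, Int.cast_one]
    refine lt_of_eq_of_lt (congrArg _ ?_) h
    push_cast
    rw [h2, hn]
    simp only [boundE, mul_pow]
    ac_rfl
  have := Int.abs_lt_one_iff.1 h3
  rcases mul_eq_zero.1 this with h | h
  · exact Or.inr h
  · exact Or.inl (pow_eq_zero_iff (by norm_num) |>.1 h)

theorem quadratic_value_eq_zero {v2 : ℤ} {β a : ℝ} (h2 : (v2 : ℝ) = (2 - β) * (2 - a))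
    (hβ : 2 < β) (hβ' : β < 2.07) (ha : -2 < a ∧ a < 2) : v2 = 0 := by
  rw [← Int.abs_lt_one_iff, ← Int.cast_lt (R := ℝ), Int.cast_abs, h2, abs_mul, Int.cast_one]
  have e1 : |2 - β| ≤ 0.07 := by rw [abs_le]; constructor <;> linarith
  have e2 : |2 - a| ≤ 4 := by rw [abs_le]; constructor <;> linarith
  calc |2 - β| * |2 - a| ≤ 0.07 * 4 := by gcongr
    _ < 1 := by norm_num

end SmallDegree

/-! ### The minimal polynomial of `α + α⁻¹` -/

section SalemTrace

/-- The conditions satisfied by `α + α⁻¹` for a Salem number `α < 1.3` of degree less than `12`. -/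
structure IsSmallSalemTrace (β : ℝ) : Prop where
  two_lt : 2 < β
  lt : β < 2.07
  isIntegral : IsIntegral ℤ β
  natDegree_le : (minpoly ℤ β).natDegree ≤ 5
  conj : ∀ z : ℂ, aeval z (minpoly ℤ β) = 0 → z = β ∨ ∃ r : ℝ, -2 < r ∧ r < 2 ∧ z = r

theorem aeval_minpoly_rat_eq {x : ℝ} (hx : IsIntegral ℤ x) (z : ℂ) :
    aeval z (minpoly ℚ x) = aeval z (minpoly ℤ x) := by
  rw [minpoly.isIntegrallyClosed_eq_field_fractions' ℚ hx, aeval_map_algebraMap]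

variable {β : ℝ}

theorem IsSmallSalemTrace.exists_roots (h : IsSmallSalemTrace β) :
    ∃ s : Multiset ℝ, s.card + 1 = (minpoly ℤ β).natDegree ∧ (∀ r ∈ s, -2 < r ∧ r < 2) ∧
      ∀ x : ℝ, aeval x (minpoly ℤ β) = (x - β) * (s.map fun r => x - r).prod := by
  classical
  have hQ : IsIntegral ℚ β := h.isIntegral.tower_top
  set f := minpoly ℤ β with hf
  have hmon : f.Monic := minpoly.monic h.isIntegral
  set F := f.map (algebraMap ℤ ℝ) with hF
  have hFmon : F.Monic := hmon.map _
  have hFz : ∀ z : ℂ, eval z (F.map (algebraMap ℝ ℂ)) = aeval z f := by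
    intro z
    rw [hF, map_map, eval_map, aeval_def]
    congr 1
  have hsplit : F.Splits := by
    refine Splits.of_splits_map (algebraMap ℝ ℂ) (IsAlgClosed.splits _) fun z hz => ?_
    have hz' := (mem_roots'.1 hz).2
    rw [IsRoot, hFz] at hz'
    rcases h.conj z hz' with rfl | ⟨r, -, -, rfl⟩
    · exact ⟨β, rfl⟩
    · exact ⟨r, rfl⟩
  -- Separability makes `β` a simple root, so after erasing it once all remaining roots lie in `(-2,
  -- 2)`.
  have hnodup : F.roots.Nodup := by
    have : F = (minpoly ℚ β).map (algebraMap ℚ ℝ) := by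
      rw [minpoly.isIntegrallyClosed_eq_field_fractions' ℚ h.isIntegral, map_map]
      congr 1
    rw [this]
    exact nodup_roots ((minpoly.irreducible hQ).separable.map)
  have hev : ∀ x : ℝ, aeval x f = F.eval x := fun x => by rw [hF, eval_map, aeval_def]
  have hβ : β ∈ F.roots := by
    rw [mem_roots hFmon.ne_zero, IsRoot, ← hev]
    exact minpoly.aeval ℤ β
  refine ⟨F.roots.erase β, ?_, fun r hr => ?_, fun x => ?_⟩
  · rw [Multiset.card_erase_add_one hβ, ← hsplit.natDegree_eq_card_roots, hF,
      hmon.natDegree_map]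
  · have hne : r ≠ β := ((Multiset.Nodup.mem_erase_iff hnodup).1 hr).1
    have hr' := (mem_roots'.1 (Multiset.mem_of_mem_erase hr)).2
    have : aeval (r : ℂ) f = 0 := by
      rw [← hFz]
      have := congrArg (algebraMap ℝ ℂ) hr'
      rw [map_zero] at this
      rw [← this, eval_map]
      exact eval₂_at_apply (algebraMap ℝ ℂ) r
    rcases h.conj _ this with h1 | ⟨t, h1, h2, h3⟩
    · exact absurd (by exact_mod_cast h1) hne
    · obtain rfl : r = t := by exact_mod_cast h3
      exact ⟨h1, h2⟩
  · rw [hev, hsplit.eval_eq_prod_roots_of_monic hFmon]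
    conv_lhs => rw [← Multiset.cons_erase hβ]
    rw [Multiset.map_cons, Multiset.prod_cons]

/-- An integer root would have to equal `β`, but `(2, 2.07)` contains no integer. -/
theorem IsSmallSalemTrace.eval_ne_zero (h : IsSmallSalemTrace β) (m : ℤ) :
    (minpoly ℤ β).eval m ≠ 0 := by
  intro h0
  have h1 : aeval ((m : ℚ) : ℂ) (minpoly ℚ β) = 0 := by
    rw [aeval_minpoly_rat_eq h.isIntegral]
    have : (((m : ℚ)) : ℂ) = algebraMap ℤ ℂ m := by simp
    rw [this, aeval_algebraMap_apply_eq_algebraMap_eval, h0, map_zero]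
  have h2 := eq_of_aeval_rat_eq_zero h.isIntegral.tower_top h1
  have h3 := h.two_lt
  have h4 := h.lt
  rw [h2] at h3 h4
  have h5 : (2 : ℤ) < m := by exact_mod_cast h3
  have h6 : (m : ℝ) < (3 : ℤ) := by
    have : (m : ℝ) < 2.07 := by exact_mod_cast h4
    push_cast
    linarith
  have h7 : m < 3 := by exact_mod_cast h6
  omega

/-- The classification of the algebraic integers `α + α⁻¹`. -/
theorem IsSmallSalemTrace.minpoly_eq (h : IsSmallSalemTrace β) :
    ∃ j, minpoly ℤ β = tracePoly j := by
  obtain ⟨s, hcard, hs, hx⟩ := h.exists_roots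
  have hne := h.eval_ne_zero
  have h5 := h.natDegree_le
  have hmon := minpoly.monic h.isIntegral
  set f := minpoly ℤ β with hf
  have hint : ∀ m : ℤ, ((f.eval m : ℤ) : ℝ) = ((m : ℝ) - β) * (s.map fun r => (m : ℝ) - r).prod := by
    intro m
    rw [← hx]
    have := aeval_algebraMap_apply_eq_algebraMap_eval (A := ℝ) m f
    simpa using this.symm
  have hcases : s.card = 0 ∨ s.card = 1 ∨ s.card = 2 ∨ s.card = 3 ∨ s.card = 4 := by omega
  rcases hcases with hc | hc | hc | hc | hc
  · exfalso
    obtain rfl := Multiset.card_eq_zero.1 hc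
    have h2 := hint 2
    simp only [Multiset.map_zero, Multiset.prod_zero, mul_one] at h2
    refine hne 2 ?_
    rw [← Int.abs_lt_one_iff, ← Int.cast_lt (R := ℝ), Int.cast_abs, h2, abs_lt]
    have := h.two_lt
    have := h.lt
    constructor <;> push_cast <;> linarith
  · exfalso
    obtain ⟨a, rfl⟩ := Multiset.card_eq_one.1 hc
    have h2 := hint 2
    simp only [Multiset.map_singleton, Multiset.prod_singleton] at h2
    exact hne 2 (quadratic_value_eq_zero (by exact_mod_cast h2) h.two_lt h.lt (hs a (by simp)))
  · exfalso
    obtain ⟨a, b, rfl⟩ := Multiset.card_eq_two.1 hc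
    have h2 := hint 2
    have hn := hint (-2)
    simp only [Multiset.insert_eq_cons, Multiset.map_cons, Multiset.map_singleton,
      Multiset.prod_cons, Multiset.prod_singleton, ← mul_assoc] at h2 hn
    rcases cubic_value_eq_zero (v2 := f.eval 2) (vn := f.eval (-2)) (by simpa using h2)
      (by simpa using hn) h.two_lt h.lt
      (hs a (by simp)) (hs b (by simp)) with h0 | h0
    · exact hne 2 h0
    · exact hne (-2) h0
  · obtain ⟨a, b, c, rfl⟩ := Multiset.card_eq_three.1 hc
    have hdeg : f.natDegree = 4 := by omega
    have hlead : f.coeff 4 = 1 := by rw [← hdeg]; exact hmon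
    have hfe : f = X ^ 4 + C (f.coeff 3) * X ^ 3 + C (f.coeff 2) * X ^ 2 + C (f.coeff 1) * X +
        C (f.coeff 0) := by
      conv_lhs => rw [f.as_sum_range_C_mul_X_pow, hdeg]
      simp only [Finset.sum_range_succ, Finset.sum_range_zero, hlead, C_1]
      ring
    have key := quartic_classification (q3 := f.coeff 3) (q2 := f.coeff 2) (q1 := f.coeff 1)
      (q0 := f.coeff 0) (β := β) (a := a) (b := b) (c := c) (fun x => by
        have h2 := hx x
        simp only [Multiset.insert_eq_cons, Multiset.map_cons, Multiset.map_singleton,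
          Multiset.prod_cons, Multiset.prod_singleton, ← mul_assoc] at h2
        rw [← h2]
        conv_rhs => rw [hfe]
        simp) h.two_lt h.lt (hs a (by simp)) (hs b (by simp)) (hs c (by simp)) (fun m => by
        have h2 := hne m
        rw [hfe] at h2
        simpa using h2)
    simp only [Prod.mk.injEq] at key
    obtain ⟨k3, k2, k1, k0⟩ := key
    refine ⟨some 3, ?_⟩
    rw [hfe, k3, k2, k1, k0]
    simp [tracePoly]
    ring
  · obtain ⟨a, b, c, d, rfl⟩ := Multiset.card_eq_four.1 hc
    have hdeg : f.natDegree = 5 := by omega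
    have hlead : f.coeff 5 = 1 := by rw [← hdeg]; exact hmon
    have hfe : f = X ^ 5 + C (f.coeff 4) * X ^ 4 + C (f.coeff 3) * X ^ 3 + C (f.coeff 2) * X ^ 2 +
        C (f.coeff 1) * X + C (f.coeff 0) := by
      conv_lhs => rw [f.as_sum_range_C_mul_X_pow, hdeg]
      simp only [Finset.sum_range_succ, Finset.sum_range_zero, hlead, C_1]
      ring
    have key := quintic_classification (q4 := f.coeff 4) (q3 := f.coeff 3) (q2 := f.coeff 2)
      (q1 := f.coeff 1) (q0 := f.coeff 0) (β := β) (a := a) (b := b) (c := c) (d := d) (fun x => by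
        have h2 := hx x
        simp only [Multiset.insert_eq_cons, Multiset.map_cons, Multiset.map_singleton,
          Multiset.prod_cons, Multiset.prod_singleton, ← mul_assoc] at h2
        rw [← h2]
        conv_rhs => rw [hfe]
        simp) h.two_lt h.lt (hs a (by simp)) (hs b (by simp)) (hs c (by simp)) (hs d (by simp))
      (fun m => by
        have h2 := hne m
        rw [hfe] at h2
        simpa using h2)
    simp only [quinticList, List.mem_cons, Prod.mk.injEq, List.not_mem_nil, or_false] at key
    rcases key with ⟨k4, k3, k2, k1, k0⟩ | ⟨k4, k3, k2, k1, k0⟩ | ⟨k4, k3, k2, k1, k0⟩ |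
      ⟨k4, k3, k2, k1, k0⟩ | ⟨k4, k3, k2, k1, k0⟩
    · refine ⟨some 0, ?_⟩
      rw [hfe, k4, k3, k2, k1, k0]
      simp [tracePoly]
      ring
    · refine ⟨some 1, ?_⟩
      rw [hfe, k4, k3, k2, k1, k0]
      simp [tracePoly]
      ring
    · refine ⟨some 2, ?_⟩
      rw [hfe, k4, k3, k2, k1, k0]
      simp [tracePoly]
      ring
    · refine ⟨some 4, ?_⟩
      rw [hfe, k4, k3, k2, k1, k0]
      simp [tracePoly]
      ring
    · refine ⟨none, ?_⟩
      rw [hfe, k4, k3, k2, k1, k0]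
      simp [tracePoly]
      ring

end SalemTrace

/-! ### Location of the roots of the trace polynomials -/

section TraceRoots

theorem exists_aeval_eq_zero_of_mul_neg (f : ℤ[X]) {a b : ℝ} (hab : a < b)
    (h : aeval a f * aeval b f < 0) : ∃ r, a < r ∧ r < b ∧ aeval r f = 0 := by
  have hc : ContinuousOn (fun x : ℝ => aeval x f) (Set.Icc a b) := f.continuous_aeval.continuousOn
  rcases mul_neg_iff.1 h with ⟨h1, h2⟩ | ⟨h1, h2⟩
  · obtain ⟨r, hr, h0⟩ := intermediate_value_Ioo' hab.le hc ⟨h2, h1⟩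
    exact ⟨r, hr.1, hr.2, h0⟩
  · obtain ⟨r, hr, h0⟩ := intermediate_value_Ioo hab.le hc ⟨h1, h2⟩
    exact ⟨r, hr.1, hr.2, h0⟩

/-- The `n` sign changes between `-2` and `2` and the one in `(lo, hi)` give `n + 1` distinct real
roots. The degree leaves no room for another complex root. -/
theorem exists_trace_roots {n : ℕ} (hn : 0 < n) {f : ℤ[X]} (hf : f.natDegree = n + 1)
    {p : Fin (n + 1) → ℝ} (hp : StrictMono p) (hp0 : p 0 = -2) (hpn : p (Fin.last n) = 2)
    {lo hi : ℝ} (hlo : 2 ≤ lo) (hlohi : lo < hi)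
    (hs : ∀ i : Fin n, aeval (p i.castSucc) f * aeval (p i.succ) f < 0)
    (hs' : aeval lo f * aeval hi f < 0) :
    ∃ β, lo < β ∧ β < hi ∧ aeval β f = 0 ∧ (∃ r : ℝ, -2 < r ∧ r < 2 ∧ aeval r f = 0) ∧
      ∀ z : ℂ, aeval z f = 0 → z = β ∨ ∃ r : ℝ, -2 < r ∧ r < 2 ∧ z = r := by
  classical
  obtain ⟨β, hβ1, hβ2, hβ⟩ := exists_aeval_eq_zero_of_mul_neg f hlohi hs'
  choose r hr1 hr2 hr using fun i : Fin n =>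
    exists_aeval_eq_zero_of_mul_neg f (hp (Fin.castSucc_lt_succ (i := i))) (hs i)
  have hlow (i : Fin n) : -2 < r i := hp0 ▸ (hp.monotone (Fin.zero_le _)).trans_lt (hr1 i)
  have hupp (i : Fin n) : r i < 2 := hpn ▸ (hr2 i).trans_le (hp.monotone (Fin.le_last _))
  have hmono : StrictMono r := fun i j hij =>
    (hr2 i).trans_le ((hp.monotone (Fin.succ_le_castSucc_iff.2 hij)).trans (hr1 j).le)
  refine ⟨β, hβ1, hβ2, hβ, ⟨r ⟨0, hn⟩, hlow _, hupp _, hr _⟩, fun z hz => ?_⟩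
  by_contra! hcon
  have hf0 : f ≠ 0 := by rintro rfl; simp at hf
  have hcast (x : ℝ) (hx : aeval x f = 0) : aeval (x : ℂ) f = 0 := by
    have := aeval_algebraMap_apply ℂ x f
    rw [hx, map_zero] at this
    exact this
  have hβmem : (β : ℂ) ∉ Finset.univ.image fun i => (r i : ℂ) := by
    intro h
    obtain ⟨i, -, hi⟩ := Finset.mem_image.1 h
    have : r i = β := by exact_mod_cast hi
    linarith [hupp i]
  have hzmem : z ∉ insert (β : ℂ) (Finset.univ.image fun i => (r i : ℂ)) := by
    intro h
    rcases Finset.mem_insert.1 h with h | h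
    · exact hcon.1 h
    · obtain ⟨i, -, rfl⟩ := Finset.mem_image.1 h
      exact hcon.2 (r i) (hlow i) (hupp i) rfl
  have hinj : Function.Injective (algebraMap ℤ ℂ) := (algebraMap ℤ ℂ).injective_int
  have hcard := card_le_degree_of_subset_roots (p := f.map (algebraMap ℤ ℂ))
    (Z := insert z (insert (β : ℂ) (Finset.univ.image fun i => (r i : ℂ)))) fun w hw => by
      rw [mem_roots ((Polynomial.map_ne_zero_iff hinj).2 hf0), IsRoot, eval_map, ← aeval_def]
      rw [Finset.mem_val, Finset.mem_insert, Finset.mem_insert, Finset.mem_image] at hw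
      rcases hw with rfl | rfl | ⟨i, -, rfl⟩
      · exact hz
      · exact hcast _ hβ
      · exact hcast _ (hr i)
  rw [Finset.card_insert_of_notMem hzmem, Finset.card_insert_of_notMem hβmem,
    Finset.card_image_of_injective _ fun i j hij => hmono.injective (by exact_mod_cast hij),
    natDegree_map_eq_of_injective hinj, hf] at hcard
  simp at hcard

/-- Disjoint intervals `(lo, hi)` isolating the largest zeros of the polynomials `tracePoly j`. -/
noncomputable def traceInterval : Option (Fin 5) → ℝ × ℝ
  | none => (2.0381, 2.0388)
  | some i => ![(2.02, 2.03), (2.04, 2.05), (2.05, 2.06), (2.06, 2.064), (2.064, 2.069)] i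

theorem traceInterval_bounds (j : Option (Fin 5)) :
    2.02 ≤ (traceInterval j).1 ∧ (traceInterval j).2 ≤ 2.069 := by
  rcases j with - | i
  · norm_num [traceInterval]
  · fin_cases i <;> norm_num [traceInterval]

theorem tracePoly_monic_natDegree (j : Option (Fin 5)) :
    (tracePoly j).Monic ∧ (tracePoly j).natDegree = if j = some 3 then 4 else 5 := by
  rcases j with - | i
  · simp only [tracePoly]
    exact ⟨by monicity!, by compute_degree!⟩
  · fin_cases i
    · simp [tracePoly]
      exact ⟨by monicity!, by compute_degree!⟩
    · simp [tracePoly]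
      exact ⟨by monicity!, by compute_degree!⟩
    · simp [tracePoly]
      exact ⟨by monicity!, by compute_degree!⟩
    · simp [tracePoly]
      exact ⟨by monicity!, by compute_degree!⟩
    · simp [tracePoly]
      exact ⟨by monicity!, by compute_degree!⟩

theorem strictMono_vec_four {a b c d : ℝ} (h1 : a < b) (h2 : b < c) (h3 : c < d) :
    StrictMono ![a, b, c, d] := by
  refine Fin.strictMono_iff_lt_succ.2 fun i => ?_
  fin_cases i
  exacts [h1, h2, h3]

theorem strictMono_vec_five {a b c d e : ℝ} (h1 : a < b) (h2 : b < c) (h3 : c < d) (h4 : d < e) :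
    StrictMono ![a, b, c, d, e] := by
  refine Fin.strictMono_iff_lt_succ.2 fun i => ?_
  fin_cases i
  exacts [h1, h2, h3, h4]

theorem exists_quintic_trace_roots {f : ℤ[X]} (hf : f.natDegree = 5) {b c d lo hi : ℝ}
    (h1 : -2 < b) (h2 : b < c) (h3 : c < d) (h4 : d < 2) (hlo : 2 ≤ lo) (hlohi : lo < hi)
    (s1 : aeval (-2 : ℝ) f * aeval b f < 0) (s2 : aeval b f * aeval c f < 0)
    (s3 : aeval c f * aeval d f < 0) (s4 : aeval d f * aeval (2 : ℝ) f < 0)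
    (s5 : aeval lo f * aeval hi f < 0) :
    ∃ β, lo < β ∧ β < hi ∧ aeval β f = 0 ∧ (∃ r : ℝ, -2 < r ∧ r < 2 ∧ aeval r f = 0) ∧
      ∀ z : ℂ, aeval z f = 0 → z = β ∨ ∃ r : ℝ, -2 < r ∧ r < 2 ∧ z = r := by
  refine exists_trace_roots (n := 4) (p := ![-2, b, c, d, 2]) (by norm_num) hf
    (strictMono_vec_five h1 h2 h3 h4) rfl rfl hlo hlohi (fun i => ?_) s5
  fin_cases i
  exacts [s1, s2, s3, s4]

theorem exists_quartic_trace_roots {f : ℤ[X]} (hf : f.natDegree = 4) {b c lo hi : ℝ}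
    (h1 : -2 < b) (h2 : b < c) (h3 : c < 2) (hlo : 2 ≤ lo) (hlohi : lo < hi)
    (s1 : aeval (-2 : ℝ) f * aeval b f < 0) (s2 : aeval b f * aeval c f < 0)
    (s3 : aeval c f * aeval (2 : ℝ) f < 0) (s4 : aeval lo f * aeval hi f < 0) :
    ∃ β, lo < β ∧ β < hi ∧ aeval β f = 0 ∧ (∃ r : ℝ, -2 < r ∧ r < 2 ∧ aeval r f = 0) ∧
      ∀ z : ℂ, aeval z f = 0 → z = β ∨ ∃ r : ℝ, -2 < r ∧ r < 2 ∧ z = r := by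
  refine exists_trace_roots (n := 3) (p := ![-2, b, c, 2]) (by norm_num) hf
    (strictMono_vec_four h1 h2 h3) rfl rfl hlo hlohi (fun i => ?_) s4
  fin_cases i
  exacts [s1, s2, s3]

theorem tracePoly_roots (j : Option (Fin 5)) :
    ∃ β, (traceInterval j).1 < β ∧ β < (traceInterval j).2 ∧ aeval β (tracePoly j) = 0 ∧
      (∃ r : ℝ, -2 < r ∧ r < 2 ∧ aeval r (tracePoly j) = 0) ∧
      ∀ z : ℂ, aeval z (tracePoly j) = 0 → z = β ∨ ∃ r : ℝ, -2 < r ∧ r < 2 ∧ z = r := by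
  match j with
  | none =>
    have hI : traceInterval none = (2.0381, 2.0388) := rfl
    have h (x : ℝ) := (aeval_tracePoly x).1
    rw [hI]
    refine exists_quintic_trace_roots (tracePoly_monic_natDegree _).2 (b := -1.5) (c := 0) (d := 0.5)
      ?_ ?_ ?_ ?_ ?_ ?_ ?_ ?_ ?_ ?_ ?_ <;> (try simp only [h]) <;> norm_num
  | some 0 =>
    have hI : traceInterval (some 0) = (2.02, 2.03) := rfl
    have h (x : ℝ) := (aeval_tracePoly x).2.1
    rw [hI]
    refine exists_quintic_trace_roots (tracePoly_monic_natDegree _).2 (b := -1.7) (c := -1) (d := 0)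
      ?_ ?_ ?_ ?_ ?_ ?_ ?_ ?_ ?_ ?_ ?_ <;> (try simp only [h]) <;> norm_num
  | some 1 =>
    have hI : traceInterval (some 1) = (2.04, 2.05) := rfl
    have h (x : ℝ) := (aeval_tracePoly x).2.2.1
    rw [hI]
    refine exists_quintic_trace_roots (tracePoly_monic_natDegree _).2 (b := -1.5) (c := -1) (d := 0)
      ?_ ?_ ?_ ?_ ?_ ?_ ?_ ?_ ?_ ?_ ?_ <;> (try simp only [h]) <;> norm_num
  | some 2 =>
    have hI : traceInterval (some 2) = (2.05, 2.06) := rfl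
    have h (x : ℝ) := (aeval_tracePoly x).2.2.2.1
    rw [hI]
    refine exists_quintic_trace_roots (tracePoly_monic_natDegree _).2 (b := -1.7) (c := -1) (d := 1)
      ?_ ?_ ?_ ?_ ?_ ?_ ?_ ?_ ?_ ?_ ?_ <;> (try simp only [h]) <;> norm_num
  | some 3 =>
    have hI : traceInterval (some 3) = (2.06, 2.064) := rfl
    have h (x : ℝ) := (aeval_tracePoly x).2.2.2.2.1
    rw [hI]
    refine exists_quartic_trace_roots (tracePoly_monic_natDegree _).2 (b := -1) (c := 0)
      ?_ ?_ ?_ ?_ ?_ ?_ ?_ ?_ ?_ <;> (try simp only [h]) <;> norm_num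
  | some 4 =>
    have hI : traceInterval (some 4) = (2.064, 2.069) := rfl
    have h (x : ℝ) := (aeval_tracePoly x).2.2.2.2.2
    rw [hI]
    refine exists_quintic_trace_roots (tracePoly_monic_natDegree _).2 (b := -1.5) (c := -1) (d := 0)
      ?_ ?_ ?_ ?_ ?_ ?_ ?_ ?_ ?_ ?_ ?_ <;> (try simp only [h]) <;> norm_num

theorem eq_of_mem_traceInterval {i j : Option (Fin 5)} {β : ℝ}
    (hi : (traceInterval i).1 < β ∧ β < (traceInterval i).2)
    (hj : (traceInterval j).1 < β ∧ β < (traceInterval j).2) : i = j := by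
  obtain ⟨h1, h2⟩ := hi
  obtain ⟨h3, h4⟩ := hj
  rcases i with - | i <;> rcases j with - | j
  · rfl
  · fin_cases j <;> norm_num [traceInterval] at h1 h2 h3 h4 <;> linarith
  · fin_cases i <;> norm_num [traceInterval] at h1 h2 h3 h4 <;> linarith
  · fin_cases i <;> fin_cases j <;> first
      | rfl
      | (norm_num [traceInterval] at h1 h2 h3 h4; linarith)

/-- The zero of `tracePoly j` larger than `2`. -/
noncomputable def traceValue (j : Option (Fin 5)) : ℝ := (tracePoly_roots j).choose

theorem traceValue_mem (j : Option (Fin 5)) :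
    (traceInterval j).1 < traceValue j ∧ traceValue j < (traceInterval j).2 :=
  ⟨(tracePoly_roots j).choose_spec.1, (tracePoly_roots j).choose_spec.2.1⟩

theorem aeval_traceValue (j : Option (Fin 5)) : aeval (traceValue j) (tracePoly j) = 0 :=
  (tracePoly_roots j).choose_spec.2.2.1

theorem tracePoly_exists_root (j : Option (Fin 5)) :
    ∃ r : ℝ, -2 < r ∧ r < 2 ∧ aeval r (tracePoly j) = 0 :=
  (tracePoly_roots j).choose_spec.2.2.2.1

theorem tracePoly_conj (j : Option (Fin 5)) (z : ℂ) (hz : aeval z (tracePoly j) = 0) :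
    z = traceValue j ∨ ∃ r : ℝ, -2 < r ∧ r < 2 ∧ z = r :=
  (tracePoly_roots j).choose_spec.2.2.2.2 z hz

theorem eq_traceValue {j : Option (Fin 5)} {β : ℝ} (hβ : 2 < β)
    (h : aeval β (tracePoly j) = 0) : β = traceValue j := by
  have h1 : aeval (β : ℂ) (tracePoly j) = 0 := by
    have := aeval_algebraMap_apply ℂ β (tracePoly j)
    rw [h, map_zero] at this
    exact this
  rcases tracePoly_conj j β h1 with h2 | ⟨r, -, h2, h3⟩
  · exact_mod_cast h2
  · have : β = r := by exact_mod_cast h3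
    linarith

theorem isSmallSalemTrace_traceValue (j : Option (Fin 5)) : IsSmallSalemTrace (traceValue j) := by
  obtain ⟨hmon, hdeg⟩ := tracePoly_monic_natDegree j
  have hi : IsIntegral ℤ (traceValue j) := ⟨_, hmon, aeval_traceValue j⟩
  have hdvd := minpoly.isIntegrallyClosed_dvd hi (aeval_traceValue j)
  obtain ⟨h1, h2⟩ := traceValue_mem j
  obtain ⟨h3, h4⟩ := traceInterval_bounds j
  refine ⟨by linarith, by linarith, hi, ?_, fun z hz => ?_⟩
  · refine (natDegree_le_of_dvd hdvd hmon.ne_zero).trans ?_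
    rw [hdeg]
    split_ifs <;> norm_num
  · obtain ⟨g, hg⟩ := hdvd
    exact tracePoly_conj j z (by rw [hg, map_mul, hz, zero_mul])

/-- Irreducibility comes for free: the classification gives some `tracePoly i` as minimal
polynomial, and disjointness of the isolating intervals forces `i = j`. -/
theorem minpoly_traceValue (j : Option (Fin 5)) : minpoly ℤ (traceValue j) = tracePoly j := by
  obtain ⟨i, hi⟩ := (isSmallSalemTrace_traceValue j).minpoly_eq
  have h : traceValue j = traceValue i :=
    eq_traceValue (isSmallSalemTrace_traceValue j).two_lt (by rw [← hi]; exact minpoly.aeval _ _)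
  rw [hi, eq_of_mem_traceInterval (i := i) (j := j) (h ▸ traceValue_mem i) (traceValue_mem j)]

theorem IsSmallSalemTrace.exists_eq_traceValue {β : ℝ} (h : IsSmallSalemTrace β) :
    ∃ j, β = traceValue j := by
  obtain ⟨j, hj⟩ := h.minpoly_eq
  exact ⟨j, eq_traceValue h.two_lt (by rw [← hj]; exact minpoly.aeval _ _)⟩

end TraceRoots

/-! ### From `α + α⁻¹` back to Salem numbers -/

section Salem

/-- Here `z` is a root of `X ^ 2 - r X + 1`, which has negative discriminant, so its roots are
conjugate with product 1. -/
theorem norm_eq_one_of_add_inv_eq {z : ℂ} {r : ℝ} (hz : z ≠ 0) (h1 : -2 < r) (h2 : r < 2)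
    (h : z + z⁻¹ = r) : ‖z‖ = 1 := by
  have hq : z * z + 1 = r * z := by rw [← h]; field_simp
  have hre := congrArg Complex.re hq
  have him := congrArg Complex.im hq
  simp at hre him
  have hr : z.im = 0 ∨ 2 * z.re = r := by
    rcases eq_or_ne z.im 0 with h0 | h0
    · exact Or.inl h0
    · exact Or.inr (mul_right_cancel₀ h0 (by linarith))
  have hsq : ‖z‖ ^ 2 = 1 := by
    rw [← Complex.normSq_eq_norm_sq, Complex.normSq_apply]
    rcases hr with h0 | h0
    · rw [h0] at hre
      nlinarith [sq_nonneg (z.re - r / 2), mul_pos (sub_pos.2 h2) (by linarith : 0 < r + 2)]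
    · rw [← h0] at hre
      linarith
  exact (pow_eq_one_iff_of_nonneg (norm_nonneg z) two_ne_zero).1 hsq

theorem eq_or_eq_inv_of_add_inv_eq {K : Type*} [Field K] {z w : K} (hz : z ≠ 0) (hw : w ≠ 0)
    (h : z + z⁻¹ = w + w⁻¹) : z = w ∨ z = w⁻¹ := by
  field_simp at h
  have : (z - w) * (z * w - 1) = 0 := by linear_combination h
  rcases mul_eq_zero.1 this with h1 | h1
  · exact Or.inl (sub_eq_zero.1 h1)
  · exact Or.inr (eq_inv_of_mul_eq_one_left (sub_eq_zero.1 h1))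

/-- The constant `2.07` is an upper bound for `1.3 + 1 / 1.3 = 2.0692…`. -/
theorem add_inv_bounds {x : ℝ} (h1 : 1 < x) (h2 : x < 1.3) : 2 < x + x⁻¹ ∧ x + x⁻¹ < 2.07 := by
  have h0 : 0 < x := by linarith
  have hx : x * x⁻¹ = 1 := mul_inv_cancel₀ h0.ne'
  have hi : 0 < x⁻¹ := inv_pos.2 h0
  have hi1 : x⁻¹ < 1 := inv_lt_one_of_one_lt₀ h1
  constructor <;> nlinarith

theorem isSmallSalemTrace_of_isSalemNumber {x : ℝ} (hx : IsSalemNumber x) (h : x < 1.3)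
    (hd : (minpoly ℚ x).natDegree < 12) : IsSmallSalemTrace (x + x⁻¹) := by
  obtain ⟨h1, hi, hinv, -, hconj⟩ := hx
  have hQ : IsIntegral ℚ x := hi.tower_top
  obtain ⟨hb1, hb2⟩ := add_inv_bounds h1 h
  have hinvi : IsIntegral ℤ x⁻¹ := by
    refine ⟨minpoly ℤ x, minpoly.monic hi, ?_⟩
    rw [minpoly.isIntegrallyClosed_eq_field_fractions' ℚ hi, aeval_map_algebraMap] at hinv
    exact hinv
  have hβ : IsIntegral ℤ (x + x⁻¹) := hi.add hinvi
  have hβQ : IsIntegral ℚ (x + x⁻¹) := hβ.tower_top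
  refine ⟨hb1, hb2, hβ, ?_, fun w hw => ?_⟩
  · have hle := natDegree_minpoly_add_inv hQ h1 hinv
    rw [minpoly.isIntegrallyClosed_eq_field_fractions' ℚ hβ,
      (minpoly.monic hβ).natDegree_map] at hle
    omega
  · rw [← aeval_minpoly_rat_eq hβ] at hw
    obtain ⟨z, hz, rfl⟩ := exists_root_add_inv_eq hQ hw
    rcases hconj z hz with rfl | rfl | hn
    · left
      push_cast
      rfl
    · left
      push_cast
      rw [inv_inv, add_comm]
    · right
      have hr : z + z⁻¹ = ((2 * z.re : ℝ) : ℂ) := by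
        rw [Complex.inv_def, Complex.normSq_eq_norm_sq, hn, Complex.ext_iff]
        constructor
        · simp
          ring
        · simp
      -- A rational conjugate would equal `x + x⁻¹ > 2`; this excludes the endpoints `-2` and `2`.
      have hne (q : ℚ) (hq : (q : ℝ) ≤ 2) : 2 * z.re ≠ q := by
        intro h0
        rw [hr, h0] at hw
        have := eq_of_aeval_rat_eq_zero hβQ (q := q) (by simpa using hw)
        linarith
      have hre := abs_le.1 (hn ▸ Complex.abs_re_le_norm z)
      have hne1 := hne (-2) (by norm_num)
      have hne2 := hne 2 (by norm_num)
      push_cast at hne1 hne2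
      exact ⟨2 * z.re, lt_of_le_of_ne (by linarith) hne1.symm,
        lt_of_le_of_ne (by linarith) hne2, hr⟩

theorem isSalemNumber_of_add_inv {α : ℝ} (h1 : 1 < α) (hα : IsIntegral ℤ α)
    (hβ : IsIntegral ℤ (α + α⁻¹))
    (hex : ∃ r : ℝ, -2 < r ∧ r < 2 ∧ aeval r (minpoly ℤ (α + α⁻¹)) = 0)
    (hconj : ∀ z : ℂ, aeval z (minpoly ℤ (α + α⁻¹)) = 0 →
      z = (α + α⁻¹ : ℝ) ∨ ∃ r : ℝ, -2 < r ∧ r < 2 ∧ z = r) : IsSalemNumber α := by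
  have hQ : IsIntegral ℚ α := hα.tower_top
  have hne0 {z : ℂ} (hz : aeval z (minpoly ℚ α) = 0) : z ≠ 0 := by
    rintro rfl
    have := eq_of_aeval_rat_eq_zero hQ (q := 0) (by simpa using hz)
    simp at this
    linarith
  obtain ⟨z, hz, hz1⟩ : ∃ z : ℂ, aeval z (minpoly ℚ α) = 0 ∧ ‖z‖ = 1 := by
    obtain ⟨r, hr1, hr2, hr⟩ := hex
    have hr' : aeval (r : ℂ) (minpoly ℚ (α + α⁻¹)) = 0 := by
      rw [aeval_minpoly_rat_eq hβ]
      have := aeval_algebraMap_apply ℂ r (minpoly ℤ (α + α⁻¹))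
      rw [hr, map_zero] at this
      exact this
    obtain ⟨z, hz, hzr⟩ := exists_root_add_inv_eq hQ hr'
    exact ⟨z, hz, norm_eq_one_of_add_inv_eq (hne0 hz) hr1 hr2 hzr⟩
  refine ⟨h1, hα, ?_, ⟨z, hz, hz1⟩, fun w hw => ?_⟩
  -- For a conjugate `z` on the unit circle, `z⁻¹` is its complex conjugate and hence a root too.
  -- Transport along an embedding makes `α⁻¹` a root.
  · rw [← aeval_inv_eq_zero_iff hQ hz, inv_eq_star_of_norm_eq_one hz1]
    exact aeval_conj_eq_zero hz
  · have hw' := (aeval_add_inv_eq_zero_iff hQ hw (minpoly ℚ (α + α⁻¹))).2 (minpoly.aeval _ _)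
    rw [aeval_minpoly_rat_eq hβ] at hw'
    have hα0 : (α : ℂ) ≠ 0 := by
      have : α ≠ 0 := by linarith
      exact_mod_cast this
    rcases hconj _ hw' with h | ⟨r, hr1, hr2, hr⟩
    · push_cast at h
      rcases eq_or_eq_inv_of_add_inv_eq (hne0 hw) hα0 h with h | h
      · exact Or.inl h
      · exact Or.inr (Or.inl (by push_cast; exact h))
    · exact Or.inr (Or.inr (norm_eq_one_of_add_inv_eq (hne0 hw) hr1 hr2 hr))

/-- `α` is a root of `X ^ 2 - b X + 1` with `b = α + α⁻¹` integral, and integrality is transitive.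
-/
theorem isIntegral_of_add_inv {α : ℝ} (h0 : α ≠ 0) (h : IsIntegral ℤ (α + α⁻¹)) :
    IsIntegral ℤ α := by
  let b : integralClosure ℤ ℝ := ⟨α + α⁻¹, h⟩
  refine isIntegral_trans (A := integralClosure ℤ ℝ) α ⟨X ^ 2 - C b * X + 1, by monicity!, ?_⟩
  have hb : algebraMap (integralClosure ℤ ℝ) ℝ b = α + α⁻¹ := rfl
  simp only [eval₂_add, eval₂_sub, eval₂_mul, eval₂_pow, eval₂_X, eval₂_C, eval₂_one, hb]
  field_simp
  ring

/-- The Salem number `α` with `α + α⁻¹ = traceValue j`. -/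
noncomputable def salemValue (j : Option (Fin 5)) : ℝ :=
  (traceValue j + √(traceValue j ^ 2 - 4)) / 2

theorem two_lt_traceValue (j : Option (Fin 5)) : 2 < traceValue j :=
  (isSmallSalemTrace_traceValue j).two_lt

theorem one_lt_salemValue (j : Option (Fin 5)) : 1 < salemValue j := by
  have h := two_lt_traceValue j
  have := Real.sqrt_nonneg (traceValue j ^ 2 - 4)
  unfold salemValue
  linarith

theorem salemValue_add_inv (j : Option (Fin 5)) :
    salemValue j + (salemValue j)⁻¹ = traceValue j := by
  have h := two_lt_traceValue j
  have h0 : salemValue j ≠ 0 := by linarith [one_lt_salemValue j]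
  have hs := Real.sq_sqrt (by nlinarith : 0 ≤ traceValue j ^ 2 - 4)
  rw [← sub_eq_zero]
  field_simp
  unfold salemValue
  linear_combination hs / 4

theorem add_inv_lt_add_inv {x y : ℝ} (hx : 1 < x) (hy : 1 < y) :
    x + x⁻¹ < y + y⁻¹ ↔ x < y := by
  have hmono : StrictMonoOn (fun t : ℝ => t + t⁻¹) (Set.Ioi 1) := by
    intro a ha b hb hab
    have ha' : (1 : ℝ) < a := ha
    have hb' : (1 : ℝ) < b := hb
    have h : b + b⁻¹ - (a + a⁻¹) = (b - a) * (a * b - 1) / (a * b) := by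
      field_simp
      ring
    have : 0 < (b - a) * (a * b - 1) / (a * b) :=
      div_pos (mul_pos (sub_pos.2 hab) (by nlinarith)) (by nlinarith)
    show a + a⁻¹ < b + b⁻¹
    linarith
  exact hmono.lt_iff_lt hx hy

theorem eq_of_add_inv_eq {x y : ℝ} (hx : 1 < x) (hy : 1 < y) (h : x + x⁻¹ = y + y⁻¹) : x = y :=
  le_antisymm (not_lt.1 fun hlt => ((add_inv_lt_add_inv hy hx).2 hlt).ne' h)
    (not_lt.1 fun hlt => ((add_inv_lt_add_inv hx hy).2 hlt).ne h)

theorem salemValue_lt (j : Option (Fin 5)) : salemValue j < 1.3 := by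
  refine (add_inv_lt_add_inv (one_lt_salemValue j) (by norm_num)).1 ?_
  rw [salemValue_add_inv]
  have h1 := (traceValue_mem j).2
  have h2 := (traceInterval_bounds j).2
  norm_num at h2 ⊢
  linarith

theorem isIntegral_salemValue (j : Option (Fin 5)) : IsIntegral ℤ (salemValue j) :=
  isIntegral_of_add_inv (by linarith [one_lt_salemValue j])
    (by rw [salemValue_add_inv]; exact (isSmallSalemTrace_traceValue j).isIntegral)

theorem isSalemNumber_salemValue (j : Option (Fin 5)) : IsSalemNumber (salemValue j) := by
  have h := salemValue_add_inv j
  refine isSalemNumber_of_add_inv (one_lt_salemValue j) (isIntegral_salemValue j) ?_ ?_ ?_ <;>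
    rw [h]
  · exact (isSmallSalemTrace_traceValue j).isIntegral
  · rw [minpoly_traceValue]
    exact tracePoly_exists_root j
  · exact (isSmallSalemTrace_traceValue j).conj

/-- All six minimal polynomials, `none` standing for `notPoly`. -/
noncomputable def salemNumberPoly (j : Option (Fin 5)) : ℚ[X] := j.elim notPoly salemPoly

theorem salemNumberPoly_monic_natDegree (j : Option (Fin 5)) :
    (salemNumberPoly j).Monic ∧
      (salemNumberPoly j).natDegree = 2 * (tracePoly j).natDegree := by
  rw [(tracePoly_monic_natDegree j).2]
  match j with
  | none =>
    simp only [salemNumberPoly, Option.elim, notPoly]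
    exact ⟨by monicity!, by compute_degree!⟩
  | some 0 =>
    simp [salemNumberPoly, salemPoly]
    exact ⟨by monicity!, by compute_degree!⟩
  | some 1 =>
    simp [salemNumberPoly, salemPoly]
    exact ⟨by monicity!, by compute_degree!⟩
  | some 2 =>
    simp [salemNumberPoly, salemPoly]
    exact ⟨by monicity!, by compute_degree!⟩
  | some 3 =>
    simp [salemNumberPoly, salemPoly]
    exact ⟨by monicity!, by compute_degree!⟩
  | some 4 =>
    simp [salemNumberPoly, salemPoly]
    exact ⟨by monicity!, by compute_degree!⟩

theorem aeval_salemNumberPoly (j : Option (Fin 5)) {x : ℝ} (hx : x ≠ 0) :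
    aeval x (salemNumberPoly j) =
      x ^ (tracePoly j).natDegree * aeval (x + x⁻¹) (tracePoly j) := by
  obtain ⟨h, h0, h1, h2, h3, h4⟩ := aeval_tracePoly (x + x⁻¹)
  rw [(tracePoly_monic_natDegree j).2]
  match j with
  | none =>
    rw [h]
    simp [salemNumberPoly, notPoly]
    field_simp
    ring
  | some 0 =>
    rw [h0]
    simp [salemNumberPoly, salemPoly]
    field_simp
    ring
  | some 1 =>
    rw [h1]
    simp [salemNumberPoly, salemPoly]
    field_simp
    ring
  | some 2 =>
    rw [h2]
    simp [salemNumberPoly, salemPoly]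
    field_simp
    ring
  | some 3 =>
    rw [h3]
    simp [salemNumberPoly, salemPoly]
    field_simp
    ring
  | some 4 =>
    rw [h4]
    simp [salemNumberPoly, salemPoly]
    field_simp
    ring

/-- The given polynomial vanishes at `salemValue j` and is monic of degree `2 * (tracePoly
j).natDegree`. The minimal polynomial divides it and has at least this degree by
`natDegree_minpoly_add_inv`. -/
theorem minpoly_salemValue (j : Option (Fin 5)) :
    minpoly ℚ (salemValue j) = salemNumberPoly j := by
  have h1 := one_lt_salemValue j
  have hQ : IsIntegral ℚ (salemValue j) := (isIntegral_salemValue j).tower_top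
  have hβ := (isSmallSalemTrace_traceValue j).isIntegral
  obtain ⟨hmon, hdeg⟩ := salemNumberPoly_monic_natDegree j
  have hroot : aeval (salemValue j) (salemNumberPoly j) = 0 := by
    rw [aeval_salemNumberPoly j (by linarith), salemValue_add_inv, aeval_traceValue, mul_zero]
  refine (eq_of_monic_of_dvd_of_natDegree_le (minpoly.monic hQ) hmon (minpoly.dvd ℚ _ hroot) ?_).symm
  have hle := natDegree_minpoly_add_inv hQ h1 (isSalemNumber_salemValue j).2.2.1
  rw [salemValue_add_inv, minpoly.isIntegrallyClosed_eq_field_fractions' ℚ hβ,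
    (minpoly.monic hβ).natDegree_map, minpoly_traceValue] at hle
  rw [hdeg]
  exact hle

theorem natDegree_minpoly_salemValue_lt (j : Option (Fin 5)) :
    (minpoly ℚ (salemValue j)).natDegree < 12 := by
  rw [minpoly_salemValue, (salemNumberPoly_monic_natDegree j).2, (tracePoly_monic_natDegree j).2]
  split_ifs <;> norm_num

theorem eq_salemValue_of_isSalemNumber {x : ℝ} (hx : IsSalemNumber x) (h : x < 1.3)
    (hd : (minpoly ℚ x).natDegree < 12) : ∃ j, x = salemValue j := by
  obtain ⟨j, hj⟩ := (isSmallSalemTrace_of_isSalemNumber hx h hd).exists_eq_traceValue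
  exact ⟨j, eq_of_add_inv_eq hx.1 (one_lt_salemValue j) (by rw [hj, salemValue_add_inv])⟩

theorem salemValue_injective : Function.Injective salemValue := by
  intro i j hij
  have h : traceValue i = traceValue j := by
    rw [← salemValue_add_inv, hij, salemValue_add_inv]
  exact eq_of_mem_traceInterval (traceValue_mem i) (h ▸ traceValue_mem j)

theorem strictMono_salemValue : StrictMono fun i => salemValue (some i) := by
  refine Fin.strictMono_iff_lt_succ.2 fun i => ?_
  rw [← add_inv_lt_add_inv (one_lt_salemValue _) (one_lt_salemValue _), salemValue_add_inv,
    salemValue_add_inv]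
  refine (traceValue_mem _).2.trans_le (le_trans ?_ (traceValue_mem _).1.le)
  match i with
  | 0 => exact show (2.03 : ℝ) ≤ 2.04 by norm_num
  | 1 => exact show (2.05 : ℝ) ≤ 2.05 by norm_num
  | 2 => exact show (2.06 : ℝ) ≤ 2.06 by norm_num
  | 3 => exact show (2.064 : ℝ) ≤ 2.064 by norm_num

/-! ### The number `√α + 1 / √α` in terms of the trace -/

section Graph

theorem graphValue_sq {α : ℝ} (h : 0 < α) : graphValue α ^ 2 = α + α⁻¹ + 2 := by
  have hs := Real.sq_sqrt h.le
  have h0 : √α ≠ 0 := (Real.sqrt_pos.2 h).ne'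
  have hi : (√α ^ 2)⁻¹ = α⁻¹ := by rw [hs]
  rw [graphValue, add_sq, hs, one_div, inv_pow, hi, mul_assoc, mul_inv_cancel₀ h0]
  ring

theorem graphValue_nonneg (α : ℝ) : 0 ≤ graphValue α := by
  unfold graphValue
  positivity

theorem graphValue_salemValue_sq (j : Option (Fin 5)) :
    graphValue (salemValue j) ^ 2 - 2 = traceValue j := by
  rw [graphValue_sq (by linarith [one_lt_salemValue j]), salemValue_add_inv]
  ring

theorem two_le_graphValue_salemValue (j : Option (Fin 5)) : 2 ≤ graphValue (salemValue j) := by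
  have h := graphValue_salemValue_sq j
  have := two_lt_traceValue j
  exact le_of_sq_le_sq (by linarith) (graphValue_nonneg _)

end Graph

end Salem

/-! ### Assembly of the main theorem -/

theorem isLargestAdjEigenvalue_tripodTree {a b c : ℕ} {l : ℝ} (hl : 2 ≤ l) (ha : 0 < a)
    (hb : 0 < b) (hc : 0 < c)
    (h : pathSeq l (a - 1) * (pathSeq l b * pathSeq l c) +
      (pathSeq l (b - 1) * (pathSeq l a * pathSeq l c) +
        pathSeq l (c - 1) * (pathSeq l a * pathSeq l b)) =
      l * (pathSeq l a * pathSeq l b * pathSeq l c)) :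
    IsLargestAdjEigenvalue (tripodTree a b c) l ∧ IsLargestAdjEigenvalueOfSomeGraph l :=
  ⟨isLargestAdjEigenvalue_of_pos _ _ (tripodVector_pos hl ha hb hc) (tripodVector_eigen ha hb hc h),
    isLargestAdjEigenvalueOfSomeGraph_of_pos _ _ (tripodVector_pos hl ha hb hc)
      (tripodVector_eigen ha hb hc h)⟩

theorem aeval_graphValue_tracePoly (j : Option (Fin 5)) :
    aeval (graphValue (salemValue j) ^ 2 - 2) (tracePoly j) = 0 := by
  rw [graphValue_salemValue_sq, aeval_traceValue]

theorem not_isLargestAdjEigenvalueOfSomeGraph_salemValue_none :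
    ¬ IsLargestAdjEigenvalueOfSomeGraph (graphValue (salemValue none)) := by
  rintro ⟨n, G, hG⟩
  have h := graphValue_salemValue_sq none
  have h0 := graphValue_nonneg (salemValue none)
  obtain ⟨h1, h2⟩ : 2.0381 < traceValue none ∧ traceValue none < 2.0388 := traceValue_mem none
  -- Since `l ^ 2` lies in `(4.0381, 4.0388)`, `l` lies in `(2.0095, 2.0097)`. This is why the
  -- interval for `none` is chosen so narrow.
  exact not_isLargestAdjEigenvalue (by nlinarith) (by nlinarith) hG

theorem mainTheorem4 :
    ∃ (αnot : ℝ) (α : Fin 5 → ℝ),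
      -- `αnot` and `α 0, …, α 4` are the roots `> 1` of, and have as minimal polynomials, the
      -- given polynomials
      minpoly ℚ αnot = notPoly ∧
      (∀ i, minpoly ℚ (α i) = salemPoly i) ∧
      -- they are the Salem numbers below `1.3` of degree less than `12`, six in number
      {x : ℝ | IsSalemNumber x ∧ x < 1.3 ∧ (minpoly ℚ x).natDegree < 12} =
        insert αnot (Set.range α) ∧
      αnot ∉ Set.range α ∧ StrictMono α ∧
      -- `αnot` is the only one of them that does not come from a graph
      {x : ℝ | IsSalemNumber x ∧ x < 1.3 ∧ (minpoly ℚ x).natDegree < 12 ∧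
        ¬ IsLargestAdjEigenvalueOfSomeGraph (graphValue x)} = {αnot} ∧
      -- the five others come from the trees `T_{2,3,6+m}`, `m = 1, …, 5`
      (∀ i : Fin 5, IsLargestAdjEigenvalue (tripodTree 2 3 (6 + (i.val + 1))) (graphValue (α i))) ∧
      -- and the fourth of these comes from `T_{2,4,5}`
      IsLargestAdjEigenvalue (tripodTree 2 4 5) (graphValue (α 3)) := by
  have htree (i : Fin 5) := isLargestAdjEigenvalue_tripodTree
    (two_le_graphValue_salemValue (some i)) two_pos three_pos (by omega : 0 < 6 + (i.val + 1))
    (tripod_two_three_center i (aeval_graphValue_tracePoly (some i)))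
  refine ⟨salemValue none, fun i => salemValue (some i), minpoly_salemValue none,
    fun i => minpoly_salemValue (some i), ?_, ?_, strictMono_salemValue, ?_, fun i => (htree i).1,
    (isLargestAdjEigenvalue_tripodTree (two_le_graphValue_salemValue (some 3)) two_pos four_pos
      (by norm_num) (tripod_two_four_center (aeval_graphValue_tracePoly (some 3)))).1⟩
  · ext x
    constructor
    · rintro ⟨hx, h, hd⟩
      obtain ⟨- | i, rfl⟩ := eq_salemValue_of_isSalemNumber hx h hd
      · exact Or.inl rfl
      · exact Or.inr ⟨i, rfl⟩
    · rintro (rfl | ⟨i, rfl⟩)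
      · exact ⟨isSalemNumber_salemValue _, salemValue_lt _, natDegree_minpoly_salemValue_lt _⟩
      · exact ⟨isSalemNumber_salemValue _, salemValue_lt _, natDegree_minpoly_salemValue_lt _⟩
  · rintro ⟨i, hi⟩
    exact Option.some_ne_none i (salemValue_injective hi)
  · ext x
    constructor
    · rintro ⟨hx, h, hd, hg⟩
      obtain ⟨- | i, rfl⟩ := eq_salemValue_of_isSalemNumber hx h hd
      · rfl
      · exact absurd (htree i).2 hg
    · rintro rfl
      exact ⟨isSalemNumber_salemValue _, salemValue_lt _, natDegree_minpoly_salemValue_lt _,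
        not_isLargestAdjEigenvalueOfSomeGraph_salemValue_none⟩
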